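/- Let $(R,\mathfrak m)$ be a Noetherian Cohen–Macaulay local ring of dimension $d\ge 2$ with infinite residue field, and let $I_1,I_2$ be $\mathfrak m$-primary ideals. Write $\ell$ for length. An element $x\in I_2$ is superficial for $I_2$ and $I_1$ if there is $r_0>0$ with $xR\cap I_1^kI_2^r=xI_1^kI_2^{r-1}$ for all $r\ge r_0$ and $k\ge 0$; a sequence $x_1,\dots,x_d$ is superficial for $I_2$ and $I_1$ if, for each $i$, the image of $x_i$ in $R/(x_1,\dots,x_{i-1})$ is superficial for the images of $I_2$ and $I_1$. We say that $I_2$ has almost minimal multiplicity with respect to $I_1$ if $\ell\big(I_1I_2/I_1(y_1,\dots,y_d)\big)=1$ for some minimal reduction $(y_1,\dots,y_d)$ of $I_2$. For $n\gg 0$ the functions $\ell(R/I_2^n)$, $\ell(R/I_1I_2^n)$ and $\ell(I_2^n/I_1I_2^n)$ agree with polynomials, and their coefficients $e_i=e_i(I_2)$, $g_i$ $(0\le i\le d)$ and $f_i$ $(0\le i\le d-1)$ are normalized by $$\ell(R/I_2^n)=\sum_{i=0}^d(-1)^ie_i\binom{n+d-i}{d-i},\qquad \ell(R/I_1I_2^n)=\sum_{i=0}^d(-1)^ig_i\binom{n+d-i}{d-i},$$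 $$\ell(I_2^n/I_1I_2^n)=\sum_{i=0}^{d-1}(-1)^if_i\binom{n+d-1-i}{d-1-i}\qquad(n\gg0).$$ Let $x_1,\dots,x_d\in I_2$ be a superficial sequence for $I_2$ and $I_1$ such that $J=(x_1,\dots,x_d)$ is a minimal reduction of $I_2$. Assume that $J\subseteq I_1$, that $J\cap I_1I_2=I_1J$, and that $I_2$ has almost minimal multiplicity with respect to $I_1$. Put $s=\min\{n\ge 0: JI_1I_2^n=I_1I_2^{n+1}\}$. Then: 1. $\displaystyle \sum_{n\ge0}\ell\Big(\frac{R}{I_1I_2^n}\Big)t^n=\frac{\ell(R/I_1)-t\,[\ell(R/I_1)-e_0+1]+t^{s+1}}{(1-t)^{d+1}}.$ 2. $g_1=e_0-\ell(R/I_1)+s$, and $g_i=\binom{s+1}{i}$ for $2\le i\le d$. 3. $\displaystyle \sum_{n\ge0}\ell\Big(\frac{I_2^n}{I_1I_2^n}\Big)t^n=\frac{\ell(R/I_1)-t\,[\ell(R/I_1)-e_0+1]+t^{s+1}}{(1-t)^{d+1}}-\sum_{n\ge0}\ell\Big(\frac{R}{I_2^n}\Big)t^n.$ 4. $f_0=e_1-e_0+\ell(R/I_1)-s$,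 and $f_i=e_{i+1}-\binom{s+1}{i+1}$ for $1\le i\le d-1$. -/

import Mathlib

open Filter IsLocalRing

namespace FiberCone

section Ring

variable {R : Type*} [CommRing R]

/-- A Noetherian local ring is Cohen-Macaulay if its maximal ideal contains a regular sequence
whose length is the Krull dimension of the ring. -/
def IsCohenMacaulayLocal (R : Type*) [CommRing R] [IsLocalRing R] : Prop :=
  ∃ rs : List R, (∀ r ∈ rs, r ∈ maximalIdeal R) ∧ RingTheory.Sequence.IsRegular R rs ∧
    ((rs.length : ℕ∞) : WithBot ℕ∞) = ringKrullDim R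

/-- `I` is primary to the maximal ideal. -/
def IsMPrimary [IsLocalRing R] (I : Ideal R) : Prop :=
  I.radical = maximalIdeal R

/-- `J` is a reduction of `I`. -/
def IsReduction (J I : Ideal R) : Prop :=
  J ≤ I ∧ ∃ n : ℕ, J * I ^ n = I ^ (n + 1)

/-- `J` is a minimal reduction of `I`: it is minimal under inclusion among the reductions. -/
def IsMinimalReduction (J I : Ideal R) : Prop :=
  IsReduction J I ∧ ∀ K : Ideal R, K ≤ J → IsReduction K I → K = J

/-- The element `x` of `I₂` is superficial for `I₂` and `I₁`. -/
def IsSuperficial (x : R) (I₂ I₁ : Ideal R) : Prop :=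
  x ∈ I₂ ∧ ∃ r₀ : ℕ, 0 < r₀ ∧ ∀ r : ℕ, r₀ ≤ r → ∀ s : ℕ,
    Ideal.span {x} ⊓ (I₁ ^ s * I₂ ^ r) = Ideal.span {x} * (I₁ ^ s * I₂ ^ (r - 1))

/-- The ideal generated by the terms of `x` that precede the term with index `i`. -/
def initialIdeal {k : ℕ} (x : Fin k → R) (i : Fin k) : Ideal R :=
  Ideal.span (x '' {j | j < i})

/-- `x` is a superficial sequence for `I₂` and `I₁`: the image of each term is superficial for the
images of `I₂` and `I₁` in the quotient by the preceding terms. -/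
def IsSuperficialSequence {k : ℕ} (x : Fin k → R) (I₂ I₁ : Ideal R) : Prop :=
  ∀ i : Fin k,
    IsSuperficial (Ideal.Quotient.mk (initialIdeal x i) (x i))
      (I₂.map (Ideal.Quotient.mk (initialIdeal x i)))
      (I₁.map (Ideal.Quotient.mk (initialIdeal x i)))

/-- The length of `I / J`, for ideals `J ≤ I`. -/
noncomputable def quotLength (I J : Ideal R) : ℕ∞ :=
  Module.length R (I ⧸ Submodule.submoduleOf J I)

/-- `I₂` has almost minimal multiplicity with respect to `I₁`, in dimension `d`: for some minimal
reduction `(x₁, …, x_d)` of `I₂` the length of `I₁I₂ / I₁(x₁, …, x_d)` is one. -/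
def HasAlmostMinimalMultiplicity (d : ℕ) (I₂ I₁ : Ideal R) : Prop :=
  ∃ x : Fin d → R, IsMinimalReduction (Ideal.span (Set.range x)) I₂ ∧
    quotLength (I₁ * I₂) (I₁ * Ideal.span (Set.range x)) = 1

/-- `s(x)`, the least `n` with `J I₁ I₂ⁿ = I₁ I₂ⁿ⁺¹`, where `J` is the ideal `(x)`. -/
noncomputable def sNumber (J I₁ I₂ : Ideal R) : ℕ :=
  sInf {n : ℕ | J * I₁ * I₂ ^ n = I₁ * I₂ ^ (n + 1)}

/-- The colength `ℓ(R / I)` as an integer, for an ideal `I` of finite colength. -/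
noncomputable def colength (I : Ideal R) : ℤ :=
  ((Module.length R (R ⧸ I)).toNat : ℤ)

/-- The Hilbert function `n ↦ ℓ(R / I₁ⁱ I₂ⁿ)`. -/
noncomputable def hilbertFn (I₁ I₂ : Ideal R) (i n : ℕ) : ℤ :=
  colength (I₁ ^ i * I₂ ^ n)

/-- The Hilbert function `n ↦ ℓ(I₂ⁿ / I₁ I₂ⁿ)` of the fiber cone of `I₂` with respect to `I₁`. -/
noncomputable def fiberHilbertFn (I₁ I₂ : Ideal R) (n : ℕ) : ℤ :=
  ((quotLength (I₂ ^ n) (I₁ * I₂ ^ n)).toNat : ℤ)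

end Ring

/-- `H n` agrees, for all large `n`, with the polynomial
`∑_{i=0}^{D} (-1)ⁱ cᵢ C(n + D - i, D - i)`; the sequence `c` is extended by zero beyond `D`. -/
def HasHilbertCoeffs (D : ℕ) (H : ℕ → ℤ) (c : ℕ → ℤ) : Prop :=
  (∀ᶠ n : ℕ in atTop, H n =
    ∑ i ∈ Finset.range (D + 1), (-1) ^ i * c i * ((n + (D - i)).choose (D - i) : ℤ)) ∧
  ∀ i, D < i → c i = 0

open Classical in
/-- The Hilbert coefficients of a function of polynomial type of degree at most `D`
(zero for all other functions). -/
noncomputable def hilbertCoeff (D : ℕ) (H : ℕ → ℤ) : ℕ → ℤ :=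
  if h : ∃ c, HasHilbertCoeffs D H c then h.choose else 0

/-- The Hilbert series `∑ H(n) tⁿ`. -/
noncomputable def hilbertSeries (H : ℕ → ℤ) : PowerSeries ℚ :=
  PowerSeries.mk fun n => (H n : ℚ)

section Coefficients

variable {R : Type*} [CommRing R]

/-- The coefficients `eᵢ(I)` of the Hilbert polynomial of `n ↦ ℓ(R / Iⁿ)`, in dimension `d`. -/
noncomputable def eCoeff (d : ℕ) (I : Ideal R) : ℕ → ℤ :=
  hilbertCoeff d (fun n => colength (I ^ n))

/-- The coefficients `gᵢ` of the Hilbert polynomial of `n ↦ ℓ(R / I₁ I₂ⁿ)`, in dimension `d`. -/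
noncomputable def gCoeff (d : ℕ) (I₁ I₂ : Ideal R) : ℕ → ℤ :=
  hilbertCoeff d (hilbertFn I₁ I₂ 1)

/-- The coefficients `fᵢ` of the Hilbert polynomial (of degree `d - 1`) of the fiber cone. -/
noncomputable def fCoeff (d : ℕ) (I₁ I₂ : Ideal R) : ℕ → ℤ :=
  hilbertCoeff (d - 1) (fiberHilbertFn I₁ I₂)

end Coefficients

end FiberCone

/-! Put `𝓕 0 = R` and `𝓕 (n + 1) = I₁ I₂ⁿ`. The condition J ∩ I₁I₂ = I₁J forces I₂ ⊆ I₁: for c ∈ I₂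
the product of c with the first term of x lies in I₁J, and comparing coefficients along a regular
sequence puts c in I₁. Hence I₂ `𝓕 n` ⊆ `𝓕 (n + 1)` in every degree.

For a regular sequence generating a reduction J, ℓ(R/I₁J) = ℓ(R/J) + d ℓ(R/I₁). Superficiality gives
ℓ(R/(x)) = e₀, while e₀ ≤ ℓ(R/(y)) for the reduction y that witnesses almost minimal multiplicity,
so ℓ(I₁I₂/I₁J) ≤ 1 for J = (x) as well. Then I₁I₂ = I₁J + (ab) for a single product, and inductively
`𝓕 (n + 2)` = J `𝓕 (n + 1)` + (abⁿ⁺¹), with the quotient by J `𝓕 (n + 1)` killed by the maximal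
ideal: all these quotients have length at most one.

The heart is `IsAlmostMinimal.strict`, which says that x₀, …, x_{d-2} behave on the associated
graded module of 𝓕 like a regular sequence. Sally's machine (`mem_of_mul_mem_of_mod`) reduces it to
dimension two (`mem_of_mul_mem_of_length_le_one`), where Rossi's argument applies. Let vₙ be the
length of `𝓕 (n + 2)` over J `𝓕 (n + 1)` and uₙ ≤ vₙ its value modulo x. Cayley–Hamilton over the
Rees algebra, applied to the Ratliff–Rush closure, gives abˡ⁺¹ ∈ J `𝓕 (l + 1)` with l ≤ ∑ uₙ. As
(uₙ) is a block of ones followed by zeros, uₙ = 1 for n < l, whereas vₙ = 0 for n ≥ l. So u = v, and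
this equality of lengths makes multiplication by x strict.

Modulo d - 1 terms of x the lengths of R/𝓕 then grow by e₀ - 1 exactly s times and by e₀ afterwards;
restoring each term divides the series by 1 - t. Expanding the numerator in powers of 1 - t gives
the gᵢ, and since g₀ = e₀ the difference with ℓ(R/I₂ⁿ) has degree d - 1 and gives the fᵢ. -/

namespace FiberCone

/-! ### Lengths of quotients and colon ideals. -/

section Colength

variable {R : Type*} [CommRing R]

/-- The quotient `R / A` has finite length. -/
def FiniteColength (A : Ideal R) : Prop :=
  Module.length R (R ⧸ A) ≠ ⊤

/-- Additivity of length on 0 → R/(A : x) → R/A → R/(A + (x)) → 0. The colon enters only through a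
membership criterion, so each application amounts to identifying a colon ideal. -/
lemma length_quotient_eq_colon_add {A C : Ideal R} {x : R} (hC : ∀ c, c ∈ C ↔ x * c ∈ A) :
    Module.length R (R ⧸ A) =
      Module.length R (R ⧸ C) + Module.length R (R ⧸ (A ⊔ Ideal.span {x})) := by
  have hCA : C ≤ Submodule.comap (LinearMap.mulLeft R x) A := fun c hc => (hC c).1 hc
  refine Module.length_eq_add_of_exact (Submodule.mapQ C A (LinearMap.mulLeft R x) hCA)
    (Submodule.factor (le_sup_left : A ≤ A ⊔ Ideal.span {x})) ?_
    (Submodule.factor_surjective _) ?_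
  · rw [injective_iff_map_eq_zero]
    intro a
    obtain ⟨a, rfl⟩ := Submodule.mkQ_surjective _ a
    intro h
    rw [Submodule.mkQ_apply, Submodule.mapQ_apply, Submodule.Quotient.mk_eq_zero] at h
    rw [Submodule.mkQ_apply, Submodule.Quotient.mk_eq_zero]
    exact (hC a).2 h
  · intro b
    obtain ⟨b, rfl⟩ := Submodule.mkQ_surjective _ b
    rw [Submodule.factor_mk, Submodule.mkQ_apply, Submodule.mkQ_apply, Submodule.Quotient.mk_eq_zero]
    constructor
    · intro h
      obtain ⟨a, ha, y, hy, rfl⟩ := Submodule.mem_sup.1 h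
      obtain ⟨c, rfl⟩ := Ideal.mem_span_singleton'.1 hy
      refine ⟨Submodule.Quotient.mk c, ?_⟩
      rw [Submodule.mapQ_apply, Submodule.Quotient.eq]
      have : LinearMap.mulLeft R x c - (a + c * x) = -a := by
        rw [LinearMap.mulLeft_apply]; ring
      rw [this]
      exact A.neg_mem ha
    · rintro ⟨c, hc⟩
      obtain ⟨c, rfl⟩ := Submodule.mkQ_surjective _ c
      rw [Submodule.mkQ_apply, Submodule.mapQ_apply, Submodule.Quotient.eq] at hc
      have hb : b = -(LinearMap.mulLeft R x c - b) + c * x := by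
        rw [LinearMap.mulLeft_apply]; ring
      rw [hb]
      exact Submodule.add_mem_sup (A.neg_mem hc) (Ideal.mem_span_singleton'.2 ⟨c, rfl⟩)

lemma length_quotient_anti {A B : Ideal R} (h : A ≤ B) :
    Module.length R (R ⧸ B) ≤ Module.length R (R ⧸ A) :=
  Module.length_le_of_surjective (Submodule.factor h) (Submodule.factor_surjective _)

lemma FiniteColength.mono {A B : Ideal R} (hA : FiniteColength A) (h : A ≤ B) :
    FiniteColength B :=
  ne_top_of_le_ne_top hA (length_quotient_anti h)

@[simp] lemma colength_top : colength (⊤ : Ideal R) = 0 := by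
  have : Module.length R (R ⧸ (⊤ : Ideal R)) = 0 :=
    Module.length_eq_zero_iff.2 (Ideal.Quotient.subsingleton_iff.2 rfl)
  rw [colength, this]; rfl

lemma colength_eq_colon_add {A C : Ideal R} {x : R} (hA : FiniteColength A)
    (hC : ∀ c, c ∈ C ↔ x * c ∈ A) :
    colength A = colength C + colength (A ⊔ Ideal.span {x}) := by
  have h := length_quotient_eq_colon_add hC
  have hAC : A ≤ C := fun c hc => (hC c).2 (A.mul_mem_left x hc)
  unfold colength
  rw [h, ENat.toNat_add (hA.mono hAC) (hA.mono le_sup_left), Nat.cast_add]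

lemma colength_anti {A B : Ideal R} (hA : FiniteColength A) (h : A ≤ B) :
    colength B ≤ colength A := by
  unfold colength
  exact_mod_cast ENat.toNat_le_toNat (length_quotient_anti h) hA

/-- The colon ideal `A : x` of an ideal by an element. -/
def colonElem (A : Ideal R) (x : R) : Ideal R := Submodule.comap (LinearMap.mulLeft R x) A

@[simp] lemma mem_colonElem {A : Ideal R} {x c : R} : c ∈ colonElem A x ↔ x * c ∈ A := by
  simp [colonElem]

lemma colength_pos {A : Ideal R} (hA : FiniteColength A) (h : A ≠ ⊤) : 0 < colength A := by
  have h1 : Module.length R (R ⧸ A) ≠ 0 := by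
    rw [Ne, Module.length_eq_zero_iff, Ideal.Quotient.subsingleton_iff]
    exact h
  unfold colength
  have := ENat.toNat_eq_zero.not.2 (not_or.2 ⟨h1, hA⟩)
  omega

lemma colength_sup_span_lt {A : Ideal R} {x : R} (hA : FiniteColength A) (hx : x ∉ A) :
    colength (A ⊔ Ideal.span {x}) < colength A := by
  have h := colength_eq_colon_add (C := colonElem A x) hA (fun c => mem_colonElem)
  have hAC : A ≤ colonElem A x := fun c hc => mem_colonElem.2 (A.mul_mem_left x hc)
  have : 0 < colength (colonElem A x) := colength_pos (hA.mono hAC) (fun ht => hx (by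
    have : (1 : R) ∈ colonElem A x := ht ▸ Submodule.mem_top
    simpa using this))
  omega

lemma eq_of_colength_le {A B : Ideal R} (hA : FiniteColength A) (h : A ≤ B)
    (hc : colength A ≤ colength B) : A = B := by
  refine le_antisymm h fun x hx => ?_
  by_contra hxA
  have h1 := colength_sup_span_lt hA hxA
  have h2 : A ⊔ Ideal.span {x} ≤ B := sup_le h ((Ideal.span_singleton_le_iff_mem _).2 hx)
  have h3 := colength_anti (hA.mono le_sup_left) h2
  omega

/-- Each element added outside the current ideal lowers the colength by at least one, so length
bounds the number of generators. -/
lemma exists_finset_sup_span_eq {A B : Ideal R} (hA : FiniteColength A) (h : A ≤ B) :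
    ∃ t : Finset R, (t.card : ℤ) ≤ colength A - colength B ∧ A ⊔ Ideal.span (t : Set R) = B := by
  classical
  obtain ⟨n, hn⟩ : ∃ n : ℕ, colength A - colength B ≤ n :=
    ⟨(colength A - colength B).toNat, Int.self_le_toNat _⟩
  induction n generalizing A with
  | zero =>
    refine ⟨∅, ?_, ?_⟩
    · have := colength_anti hA h
      simpa using this
    · simpa using eq_of_colength_le hA h (by simpa using hn)
  | succ n ih =>
    by_cases hAB : A = B
    · exact ⟨∅, by simp [hAB], by simp [hAB]⟩
    obtain ⟨x, hxB, hxA⟩ := SetLike.exists_of_lt (lt_of_le_of_ne h hAB)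
    have h1 := colength_sup_span_lt hA hxA
    have h2 : A ⊔ Ideal.span {x} ≤ B := sup_le h ((Ideal.span_singleton_le_iff_mem _).2 hxB)
    obtain ⟨t, ht, hs⟩ := ih (hA.mono le_sup_left) h2 (by push_cast at hn; omega)
    refine ⟨insert x t, ?_, ?_⟩
    · have := Finset.card_insert_le x t
      omega
    · rw [← hs, Finset.coe_insert, Ideal.span_insert, sup_assoc]

lemma quotLength_add_length {A B : Ideal R} (h : A ≤ B) :
    quotLength B A + Module.length R (R ⧸ B) = Module.length R (R ⧸ A) := by
  symm
  have hAB : Submodule.submoduleOf A B ≤ Submodule.comap B.subtype A := le_rfl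
  refine Module.length_eq_add_of_exact
    (Submodule.mapQ (Submodule.submoduleOf A B) A B.subtype hAB)
    (Submodule.factor h) ?_ (Submodule.factor_surjective _) ?_
  · rw [injective_iff_map_eq_zero]
    intro a
    obtain ⟨a, rfl⟩ := Submodule.mkQ_surjective _ a
    intro h
    rw [Submodule.mkQ_apply, Submodule.mapQ_apply, Submodule.Quotient.mk_eq_zero] at h
    rw [Submodule.mkQ_apply, Submodule.Quotient.mk_eq_zero]
    exact h
  · intro b
    obtain ⟨b, rfl⟩ := Submodule.mkQ_surjective _ b
    rw [Submodule.factor_mk, Submodule.mkQ_apply, Submodule.mkQ_apply, Submodule.Quotient.mk_eq_zero]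
    constructor
    · intro hb
      exact ⟨Submodule.Quotient.mk ⟨b, hb⟩, by rw [Submodule.mapQ_apply]; rfl⟩
    · rintro ⟨c, hc⟩
      obtain ⟨c, rfl⟩ := Submodule.mkQ_surjective _ c
      rw [Submodule.mkQ_apply, Submodule.mapQ_apply, Submodule.Quotient.eq] at hc
      have := B.sub_mem c.2 (h hc)
      simpa using this

lemma toNat_quotLength {A B : Ideal R} (hA : FiniteColength A) (h : A ≤ B) :
    ((quotLength B A).toNat : ℤ) = colength A - colength B := by
  have h1 := quotLength_add_length h
  have h2 : quotLength B A ≠ ⊤ := fun ht => hA (by rw [← h1, ht, top_add])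
  unfold colength
  rw [← h1, ENat.toNat_add h2 (hA.mono h)]
  push_cast; ring

lemma finiteColength_of_pow_le [IsLocalRing R] [IsNoetherianRing R] {A : Ideal R} {k : ℕ}
    (h : maximalIdeal R ^ k ≤ A) : FiniteColength A := by
  by_cases hA : A = ⊤
  · have : Module.length R (R ⧸ A) = 0 :=
      Module.length_eq_zero_iff.2 (Ideal.Quotient.subsingleton_iff.2 hA)
    simp [FiniteColength, this]
  have : Nontrivial (R ⧸ A) := Ideal.Quotient.nontrivial_iff.2 hA
  have : IsLocalRing (R ⧸ A) :=
    IsLocalRing.of_surjective' (Ideal.Quotient.mk A) Ideal.Quotient.mk_surjective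
  have hart : IsArtinianRing (R ⧸ A) := by
    rw [isArtinianRing_iff_isNilpotent_maximalIdeal]
    refine ⟨k, ?_⟩
    have : maximalIdeal (R ⧸ A) = (maximalIdeal R).map (Ideal.Quotient.mk A) := by
      symm
      exact IsLocalRing.map_maximalIdeal_of_surjective _ Ideal.Quotient.mk_surjective
    rw [this, ← Ideal.map_pow, Ideal.zero_eq_bot, ← le_bot_iff, Ideal.map_le_iff_le_comap]
    intro x hx
    simpa [Ideal.mem_comap, Ideal.Quotient.eq_zero_iff_mem] using h hx
  have : IsArtinian R (R ⧸ A) :=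
    isArtinian_of_surjective_algebraMap (R := R ⧸ A) (M := R ⧸ A) Ideal.Quotient.mk_surjective
  exact Module.length_ne_top

lemma colength_maximalIdeal [IsLocalRing R] : colength (maximalIdeal R) = 1 := by
  have : IsSimpleModule R (R ⧸ maximalIdeal R) :=
    isSimpleModule_iff_isCoatom.2 (Ideal.isMaximal_def.1 (maximalIdeal.isMaximal R))
  simp [colength, Module.length_eq_one]

lemma finiteColength_maximalIdeal [IsLocalRing R] : FiniteColength (maximalIdeal R) := by
  have : IsSimpleModule R (R ⧸ maximalIdeal R) :=
    isSimpleModule_iff_isCoatom.2 (Ideal.isMaximal_def.1 (maximalIdeal.isMaximal R))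
  simp [FiniteColength, Module.length_eq_one]

end Colength

/-! ### Regular sequences, associated primes and dimension. -/

section CohenMacaulay

variable {R : Type*} [CommRing R]

/-- `x` is a nonzerodivisor modulo `Q`. -/
def IsRegularMod (Q : Ideal R) (x : R) : Prop := ∀ c, x * c ∈ Q → c ∈ Q

/-- The maximal ideal contains a sequence of length `n` that is weakly regular modulo `Q`. -/
def HasRegularChain [IsLocalRing R] : ℕ → Ideal R → Prop
  | 0, _ => True
  | n + 1, Q => ∃ z ∈ maximalIdeal R, IsRegularMod Q z ∧ HasRegularChain n (Q ⊔ Ideal.span {z})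

/-- `P` is a prime ideal of the form `Q : a` with `a ∉ Q`. -/
def IsPrimeColon (Q P : Ideal R) : Prop :=
  P.IsPrime ∧ ∃ a, a ∉ Q ∧ ∀ c, c ∈ P ↔ c * a ∈ Q

lemma mem_colon_mk {Q : Ideal R} {a c : R} :
    c ∈ (⊥ : Submodule R (R ⧸ Q)).colon {Submodule.Quotient.mk a} ↔ c * a ∈ Q := by
  rw [Submodule.mem_colon_singleton, Submodule.mem_bot, ← Submodule.Quotient.mk_smul,
    Submodule.Quotient.mk_eq_zero, smul_eq_mul]

lemma isPrimeColon_iff [IsNoetherianRing R] {Q P : Ideal R} :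
    IsPrimeColon Q P ↔ IsAssociatedPrime P (R ⧸ Q) := by
  rw [isAssociatedPrime_iff]
  refine and_congr_right fun hP => ⟨?_, ?_⟩
  · rintro ⟨a, -, h⟩
    exact ⟨Submodule.Quotient.mk a, Ideal.ext fun c => (h c).trans mem_colon_mk.symm⟩
  · rintro ⟨a, h⟩
    obtain ⟨a, rfl⟩ := Submodule.mkQ_surjective _ a
    have h' : ∀ c, c ∈ P ↔ c * a ∈ Q := fun c => by rw [h]; exact mem_colon_mk
    exact ⟨a, fun ha => hP.ne_top ((Ideal.eq_top_iff_one _).2 ((h' 1).2 (by simpa using ha))), h'⟩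

lemma finite_isPrimeColon [IsNoetherianRing R] (Q : Ideal R) : {P | IsPrimeColon Q P}.Finite := by
  have : {P | IsPrimeColon Q P} = associatedPrimes R (R ⧸ Q) := by
    ext P
    exact isPrimeColon_iff
  rw [this]
  exact associatedPrimes.finite R (R ⧸ Q)

lemma exists_isPrimeColon [IsNoetherianRing R] {Q : Ideal R} {b : R} (hb : b ∉ Q) :
    ∃ P, IsPrimeColon Q P ∧ ∀ c, c * b ∈ Q → c ∈ P := by
  obtain ⟨P, hP, h⟩ := exists_le_isAssociatedPrime_of_isNoetherianRing R
    (Submodule.Quotient.mk b : R ⧸ Q) (by rwa [Ne, Submodule.Quotient.mk_eq_zero])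
  exact ⟨P, isPrimeColon_iff.2 hP, fun c hc => h (mem_colon_mk.2 hc)⟩

lemma isRegularMod_of_forall_notMem [IsNoetherianRing R] {Q : Ideal R} {x : R}
    (h : ∀ P, IsPrimeColon Q P → x ∉ P) : IsRegularMod Q x := by
  intro c hc
  by_contra hcQ
  obtain ⟨P, hP, hle⟩ := exists_isPrimeColon hcQ
  exact h P hP (hle x hc)

lemma IsRegularMod.notMem {Q P : Ideal R} {x : R} (hx : IsRegularMod Q x)
    (hP : IsPrimeColon Q P) : x ∉ P := by
  obtain ⟨_, a, ha, h⟩ := hP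
  exact fun hxP => ha (hx a ((h x).1 hxP))

lemma exists_regular_mem_of_not_le [IsNoetherianRing R] {Q₁ Q₂ I : Ideal R}
    (h₁ : ∀ P, IsPrimeColon Q₁ P → ¬ I ≤ P) (h₂ : ∀ P, IsPrimeColon Q₂ P → ¬ I ≤ P) :
    ∃ w ∈ I, IsRegularMod Q₁ w ∧ IsRegularMod Q₂ w := by
  set S : Set (Ideal R) := {P | IsPrimeColon Q₁ P} ∪ {P | IsPrimeColon Q₂ P} with hS
  have hfin : S.Finite := (finite_isPrimeColon Q₁).union (finite_isPrimeColon Q₂)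
  have hnot : ¬ ((I : Set R) ⊆ ⋃ P ∈ S, ((id P : Ideal R) : Set R)) := by
    rw [Ideal.subset_union_prime_finite hfin (f := id) 0 0]
    · rintro ⟨P, hP | hP, hle⟩
      · exact h₁ P hP hle
      · exact h₂ P hP hle
    · rintro P (hP | hP) - -
      · exact hP.1
      · exact hP.1
  obtain ⟨w, hwI, hw⟩ := Set.not_subset.1 hnot
  simp only [Set.mem_iUnion, not_exists] at hw
  exact ⟨w, hwI, isRegularMod_of_forall_notMem fun P hP => hw P (Or.inl hP),
    isRegularMod_of_forall_notMem fun P hP => hw P (Or.inr hP)⟩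

variable [IsLocalRing R] [IsNoetherianRing R]

lemma le_of_le_sup_mul {Q N A : Ideal R} (hA : A ≤ maximalIdeal R) (h : N ≤ Q ⊔ A * N) :
    N ≤ Q := by
  refine Submodule.le_of_le_smul_of_le_jacobson_bot (I := A) (IsNoetherian.noetherian _) ?_ h
  rwa [IsLocalRing.jacobson_eq_maximalIdeal ⊥ bot_ne_top]

/-- Two elements that form a regular sequence modulo `Q` may be interchanged. -/
lemma IsRegularMod.swap {Q : Ideal R} {y w : R} (hym : y ∈ maximalIdeal R)
    (hy : IsRegularMod Q y) (hw : IsRegularMod (Q ⊔ Ideal.span {y}) w) :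
    IsRegularMod Q w ∧ IsRegularMod (Q ⊔ Ideal.span {w}) y := by
  have h1 : IsRegularMod Q w := by
    -- With N = Q : w, regularity of w and then of y gives N ⊆ Q + yN, and Nakayama concludes.
    have : colonElem Q w ≤ Q := by
      refine le_of_le_sup_mul (A := Ideal.span {y})
        ((Ideal.span_singleton_le_iff_mem _).2 hym) fun c hc => ?_
      rw [mem_colonElem] at hc
      obtain ⟨q, hq, t, ht, rfl⟩ := Submodule.mem_sup.1 (hw c (Ideal.mem_sup_left hc))
      obtain ⟨e, rfl⟩ := Ideal.mem_span_singleton.1 ht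
      refine Submodule.add_mem_sup hq (Ideal.mul_mem_mul (Ideal.mem_span_singleton_self y) ?_)
      rw [mem_colonElem]
      apply hy
      have : y * (w * e) = w * (q + y * e) - w * q := by ring
      rw [this]
      exact Q.sub_mem hc (Q.mul_mem_left _ hq)
    exact fun c hc => this (mem_colonElem.2 hc)
  refine ⟨h1, fun c hc => ?_⟩
  obtain ⟨q, hq, t, ht, hqt⟩ := Submodule.mem_sup.1 hc
  obtain ⟨e, rfl⟩ := Ideal.mem_span_singleton.1 ht
  have he : e ∈ Q ⊔ Ideal.span {y} := by
    apply hw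
    have : w * e = -q + y * c := by rw [← hqt]; ring
    rw [this]
    exact Submodule.add_mem_sup (Q.neg_mem hq) (Ideal.mem_span_singleton.2 ⟨c, rfl⟩)
  obtain ⟨q', hq', t, ht', rfl⟩ := Submodule.mem_sup.1 he
  obtain ⟨f, rfl⟩ := Ideal.mem_span_singleton.1 ht'
  have hcf : c - w * f ∈ Q := by
    apply hy
    have : y * (c - w * f) = q + w * q' := by linear_combination -hqt
    rw [this]
    exact Q.add_mem hq (Q.mul_mem_left _ hq')
  have : c = (c - w * f) + w * f := by ring
  rw [this]
  exact Submodule.add_mem_sup hcf (Ideal.mem_span_singleton.2 ⟨f, rfl⟩)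

omit [IsNoetherianRing R] in
/-- If some element of the maximal ideal is regular modulo `Q + (z)`, then the maximal ideal is not
associated to `Q + (y)` for any two elements `y`, `z` that are regular modulo `Q`. -/
lemma not_maximalIdeal_le_of_isPrimeColon {Q P : Ideal R} {y z z' : R}
    (hzm : z ∈ maximalIdeal R) (hy : IsRegularMod Q y) (hz : IsRegularMod Q z)
    (hz'm : z' ∈ maximalIdeal R) (hz' : IsRegularMod (Q ⊔ Ideal.span {z}) z')
    (hP : IsPrimeColon (Q ⊔ Ideal.span {y}) P) : ¬ maximalIdeal R ≤ P := by
  intro hle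
  obtain ⟨_, a, ha, h⟩ := hP
  -- Modulo Q write za = yb and z'a = ye. Cancelling y gives z'b = ze, so b = zf since z' is regular
  -- modulo z; cancelling z leaves a = yf, contrary to the choice of a.
  have key : ∀ c ∈ maximalIdeal R, ∃ e, c * a - y * e ∈ Q := by
    intro c hc
    obtain ⟨q, hq, t, ht, hqt⟩ := Submodule.mem_sup.1 ((h c).1 (hle hc))
    obtain ⟨e, rfl⟩ := Ideal.mem_span_singleton.1 ht
    exact ⟨e, by rw [← hqt]; simpa using hq⟩
  obtain ⟨b, hb⟩ := key z hzm
  obtain ⟨e, he⟩ := key z' hz'm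
  have hbz : b ∈ Q ⊔ Ideal.span {z} := by
    apply hz'
    have h1 : z' * b - z * e ∈ Q := by
      apply hy
      have : y * (z' * b - z * e) = z * (z' * a - y * e) - z' * (z * a - y * b) := by ring
      rw [this]
      exact Q.sub_mem (Q.mul_mem_left _ he) (Q.mul_mem_left _ hb)
    have : z' * b = (z' * b - z * e) + z * e := by ring
    rw [this]
    exact Submodule.add_mem_sup h1 (Ideal.mem_span_singleton.2 ⟨e, rfl⟩)
  obtain ⟨q, hq, t, ht, rfl⟩ := Submodule.mem_sup.1 hbz
  obtain ⟨f, rfl⟩ := Ideal.mem_span_singleton.1 ht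
  apply ha
  have h2 : a - y * f ∈ Q := by
    apply hz
    have : z * (a - y * f) = (z * a - y * (q + z * f)) + y * q := by ring
    rw [this]
    exact Q.add_mem hb (Q.mul_mem_left _ hq)
  have : a = (a - y * f) + y * f := by ring
  rw [this]
  exact Submodule.add_mem_sup h2 (Ideal.mem_span_singleton.2 ⟨f, rfl⟩)

/-- Exchange argument for depth: prime avoidance supplies a w regular modulo both Q + (y) and Q +
(z), with z the head of the chain. Swapping turns w into a common first element, and induction
applies modulo z and then modulo w. -/
lemma HasRegularChain.sup_span {n : ℕ} {Q : Ideal R} {y : R} (h : HasRegularChain (n + 1) Q)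
    (hym : y ∈ maximalIdeal R) (hy : IsRegularMod Q y) :
    HasRegularChain n (Q ⊔ Ideal.span {y}) := by
  induction n generalizing Q y with
  | zero => trivial
  | succ n ih =>
    obtain ⟨z, hzm, hz, hzchain⟩ := h
    obtain ⟨z', hz'm, hz', -⟩ := id hzchain
    obtain ⟨w, hwm, hwy, hwz⟩ := exists_regular_mem_of_not_le
      (fun P hP => not_maximalIdeal_le_of_isPrimeColon hzm hy hz hz'm hz' hP)
      (fun P hP => not_maximalIdeal_le_of_isPrimeColon hzm hz hz hz'm hz' hP)
    obtain ⟨hw, hzw⟩ := hz.swap hzm hwz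
    obtain ⟨-, hyw⟩ := hy.swap hym hwy
    have h1 : HasRegularChain n (Q ⊔ Ideal.span {z} ⊔ Ideal.span {w}) := ih hzchain hwm hwz
    rw [sup_right_comm] at h1
    have h2 : HasRegularChain (n + 1) (Q ⊔ Ideal.span {w}) := ⟨z, hzm, hzw, h1⟩
    have h3 := ih h2 hym hyw
    rw [sup_right_comm] at h3
    exact ⟨w, hwm, hwy, h3⟩

/-- Depth is at most dim R/P for each associated prime P: modulo a regular z some associated prime
contains P and z, hence is strictly larger than P, and the dimension drops. -/
lemma HasRegularChain.le_ringKrullDim {n : ℕ} {Q P : Ideal R} (h : HasRegularChain n Q)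
    (hP : IsPrimeColon Q P) : (n : WithBot ℕ∞) ≤ ringKrullDim (R ⧸ P) := by
  induction n generalizing Q P with
  | zero =>
    have := Ideal.Quotient.nontrivial_iff.2 hP.1.ne_top
    exact_mod_cast ringKrullDim_nonneg_of_nontrivial
  | succ n ih =>
    obtain ⟨z, hzm, hz, hchain⟩ := h
    obtain ⟨hprime, a, ha, hPa⟩ := id hP
    -- If N = Q : P were contained in Q + (z), regularity of z would give N ⊆ Q + zN, so N ⊆ Q by
    -- Nakayama; but a ∈ N is outside Q.
    obtain ⟨b, hbP, hbz⟩ : ∃ b, (∀ c ∈ P, c * b ∈ Q) ∧ b ∉ Q ⊔ Ideal.span {z} := by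
      by_contra! hcon
      set N : Ideal R := ⨅ c ∈ P, colonElem Q c with hN
      have hNmem : ∀ b, b ∈ N ↔ ∀ c ∈ P, c * b ∈ Q := by simp [hN]
      have hle : N ≤ Q := by
        refine le_of_le_sup_mul (A := Ideal.span {z})
          ((Ideal.span_singleton_le_iff_mem _).2 hzm) fun b hb => ?_
        rw [hNmem] at hb
        obtain ⟨q, hq, t, ht, rfl⟩ := Submodule.mem_sup.1 (hcon b hb)
        obtain ⟨e, rfl⟩ := Ideal.mem_span_singleton.1 ht
        refine Submodule.add_mem_sup hq (Ideal.mul_mem_mul (Ideal.mem_span_singleton_self z) ?_)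
        rw [hNmem]
        intro c hc
        apply hz
        have : z * (c * e) = c * (q + z * e) - c * q := by ring
        rw [this]
        exact Q.sub_mem (hb c hc) (Q.mul_mem_left _ hq)
      exact ha (hle ((hNmem a).2 fun c hc => (hPa c).1 hc))
    obtain ⟨P', hP', hle⟩ := exists_isPrimeColon hbz
    have hPP' : P ≤ P' := fun c hc => hle c (Ideal.mem_sup_left (hbP c hc))
    have hzP' : z ∈ P' := hle z
      (Ideal.mem_sup_right (Ideal.mul_mem_right _ _ (Ideal.mem_span_singleton_self z)))
    have hzP : z ∉ P := hz.notMem hP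
    have h1 := ih hchain hP'
    have h2 : ringKrullDim (R ⧸ P') + 1 ≤ ringKrullDim (R ⧸ P) := by
      refine ringKrullDim_succ_le_of_surjective (Ideal.Quotient.factor hPP')
        (Ideal.Quotient.factor_surjective hPP') (r := Ideal.Quotient.mk P z) ?_ ?_
      · rw [mem_nonZeroDivisors_iff_ne_zero, Ne, Ideal.Quotient.eq_zero_iff_mem]
        exact hzP
      · rw [Ideal.Quotient.factor_mk, Ideal.Quotient.eq_zero_iff_mem]
        exact hzP'
    push_cast
    exact (add_le_add_left h1 1).trans h2

lemma ringKrullDim_quotient_le_card {P : Ideal R} (hP : P ≠ ⊤) {s : Finset R}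
    (hs : (s : Set R) ⊆ maximalIdeal R)
    (h : maximalIdeal R ≤ (P ⊔ Ideal.span (s : Set R)).radical) :
    ringKrullDim (R ⧸ P) ≤ s.card := by
  classical
  have : Nontrivial (R ⧸ P) := Ideal.Quotient.nontrivial_iff.2 hP
  have : IsLocalRing (R ⧸ P) :=
    IsLocalRing.of_surjective' (Ideal.Quotient.mk P) Ideal.Quotient.mk_surjective
  set t := s.image (Ideal.Quotient.mk P) with ht
  have hmax : maximalIdeal (R ⧸ P) = (maximalIdeal R).map (Ideal.Quotient.mk P) :=
    (IsLocalRing.map_maximalIdeal_of_surjective _ Ideal.Quotient.mk_surjective).symm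
  have htm : (t : Set (R ⧸ P)) ⊆ Ring.jacobson (R ⧸ P) := by
    rw [IsLocalRing.ringJacobson_eq_maximalIdeal, hmax, ht]
    intro a ha
    obtain ⟨b, hb, rfl⟩ := Finset.mem_image.1 (Finset.mem_coe.1 ha)
    exact Ideal.mem_map_of_mem _ (hs hb)
  have h0 : ringKrullDim ((R ⧸ P) ⧸ Ideal.span (t : Set (R ⧸ P))) ≤ 0 := by
    rw [ringKrullDim_quotient]
    have : Subsingleton (PrimeSpectrum.zeroLocus
        ((Ideal.span (t : Set (R ⧸ P)) : Ideal (R ⧸ P)) : Set (R ⧸ P))) := by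
      suffices hp : ∀ p ∈ PrimeSpectrum.zeroLocus
          ((Ideal.span (t : Set (R ⧸ P)) : Ideal (R ⧸ P)) : Set (R ⧸ P)),
          p.asIdeal = maximalIdeal (R ⧸ P) from
        ⟨fun p q => Subtype.ext (PrimeSpectrum.ext ((hp p p.2).trans (hp q q.2).symm))⟩
      intro p hp
      refine le_antisymm (IsLocalRing.le_maximalIdeal p.2.ne_top) ?_
      rw [hmax, Ideal.map_le_iff_le_comap]
      refine h.trans ((Ideal.IsPrime.radical_le_iff inferInstance).2 (sup_le ?_ ?_))
      · intro c hc
        rw [Ideal.mem_comap, Ideal.Quotient.eq_zero_iff_mem.2 hc]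
        exact p.asIdeal.zero_mem
      · rw [Ideal.span_le]
        intro c hc
        exact hp (Ideal.subset_span (Finset.mem_coe.2 (Finset.mem_image_of_mem _ hc)))
    exact Order.krullDim_nonpos_of_subsingleton
  have h1 := ringKrullDim_le_ringKrullDim_quotient_add_card t htm
  calc ringKrullDim (R ⧸ P) ≤ 0 + (t.card : WithBot ℕ∞) := h1.trans (add_le_add_left h0 _)
    _ ≤ s.card := by
      rw [zero_add]
      exact_mod_cast Finset.card_image_le

/-- An associated prime containing y would have a quotient of dimension at most |s|, fewer than the
n guaranteed by depth. -/
lemma HasRegularChain.isRegularMod {n : ℕ} {Q : Ideal R} {y : R} {s : Finset R}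
    (h : HasRegularChain n Q) (hsn : s.card < n) (hs : (s : Set R) ⊆ maximalIdeal R)
    (hm : maximalIdeal R ≤ (Q ⊔ Ideal.span {y} ⊔ Ideal.span (s : Set R)).radical) :
    IsRegularMod Q y := by
  refine isRegularMod_of_forall_notMem fun P hP hyP => ?_
  have hQP : Q ≤ P := fun c hc => by
    obtain ⟨-, a, -, hPa⟩ := id hP
    exact (hPa c).2 (Q.mul_mem_right _ hc)
  have h1 := h.le_ringKrullDim hP
  have h2 := ringKrullDim_quotient_le_card hP.1.ne_top hs (hm.trans (Ideal.radical_mono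
    (sup_le_sup_right (sup_le hQP ((Ideal.span_singleton_le_iff_mem _).2 hyP)) _)))
  have h3 : n ≤ s.card := by exact_mod_cast h1.trans h2
  omega

omit [IsNoetherianRing R] in
lemma hasRegularChain_of_isRegular {rs : List R} (hm : ∀ r ∈ rs, r ∈ maximalIdeal R)
    (h : RingTheory.Sequence.IsWeaklyRegular R rs) : HasRegularChain rs.length (⊥ : Ideal R) := by
  suffices hk : ∀ k i, i + k = rs.length → HasRegularChain k (Ideal.ofList (rs.take i)) by
    simpa using hk rs.length 0 (by simp)
  intro k
  induction k with
  | zero => intros; trivial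
  | succ k ih =>
    intro i hi
    have hlt : i < rs.length := by omega
    refine ⟨rs[i], hm _ (List.getElem_mem hlt), ?_, ?_⟩
    · have := (isSMulRegular_quotient_iff_mem_of_smul_mem _ _).1 (h.regular_mod_prev i hlt)
      intro c hc
      simpa using this c (by simpa using hc)
    · have := ih (i + 1) (by omega)
      rwa [← List.take_append_getElem hlt, Ideal.ofList_append, Ideal.ofList_singleton] at this

end CohenMacaulay

/-! ### Ideals generated by initial segments of a regular sequence. -/

section PartialIdeal

variable {R : Type*} [CommRing R]

/-- The ideal generated by the first `i` terms of `x`. -/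
def partialIdeal (x : ℕ → R) (i : ℕ) : Ideal R := Ideal.span (x '' Set.Iio i)

@[simp] lemma partialIdeal_zero (x : ℕ → R) : partialIdeal x 0 = ⊥ := by
  simp [partialIdeal]

lemma partialIdeal_succ (x : ℕ → R) (i : ℕ) :
    partialIdeal x (i + 1) = partialIdeal x i ⊔ Ideal.span {x i} := by
  have : Set.Iio (i + 1) = Set.Iio i ∪ {i} := by
    ext j
    simp only [Set.mem_Iio, Set.mem_union, Set.mem_singleton_iff]
    omega
  rw [partialIdeal, partialIdeal, this, Set.image_union, Set.image_singleton, Ideal.span_union]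

lemma partialIdeal_mono (x : ℕ → R) {i j : ℕ} (h : i ≤ j) : partialIdeal x i ≤ partialIdeal x j :=
  Ideal.span_mono (Set.image_mono (Set.Iio_subset_Iio h))

lemma mem_partialIdeal (x : ℕ → R) {i j : ℕ} (h : j < i) : x j ∈ partialIdeal x i :=
  Ideal.subset_span (Set.mem_image_of_mem x h)

lemma mem_mul_partialIdeal {A : Ideal R} {x : ℕ → R} {i : ℕ} {c : R} :
    c ∈ A * partialIdeal x i ↔
      ∃ a : ℕ → R, (∀ j, a j ∈ A) ∧ c = ∑ j ∈ Finset.range i, a j * x j := by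
  constructor
  · intro h
    induction i generalizing c with
    | zero => exact ⟨0, by simp, by simpa using h⟩
    | succ i ih =>
      rw [partialIdeal_succ, Ideal.mul_sup] at h
      obtain ⟨u, hu, v, hv, rfl⟩ := Submodule.mem_sup.1 h
      obtain ⟨a, ha, rfl⟩ := ih hu
      obtain ⟨b, hb, rfl⟩ := Ideal.mem_mul_span_singleton.1 hv
      refine ⟨Function.update a i b, fun j => ?_, ?_⟩
      · by_cases hj : j = i
        · subst hj; simpa using hb
        · simpa [hj] using ha j
      · rw [Finset.sum_range_succ, Function.update_self]
        congr 1
        refine Finset.sum_congr rfl fun j hj => ?_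
        rw [Function.update_of_ne (Finset.mem_range.1 hj).ne]
  · rintro ⟨a, ha, rfl⟩
    exact Ideal.sum_mem _ fun j hj =>
      Ideal.mul_mem_mul (ha j) (mem_partialIdeal x (Finset.mem_range.1 hj))

lemma mem_partialIdeal_iff {x : ℕ → R} {i : ℕ} {c : R} :
    c ∈ partialIdeal x i ↔ ∃ a : ℕ → R, c = ∑ j ∈ Finset.range i, a j * x j := by
  have := mem_mul_partialIdeal (A := ⊤) (x := x) (i := i) (c := c)
  simpa using this

/-- The last coefficient lies in the ideal of the earlier terms by regularity; substituting its
expansion shortens the relation. This is the part of Koszul exactness that is needed. -/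
lemma coeff_mem_of_sum_eq_zero {x : ℕ → R} {d : ℕ}
    (hreg : ∀ i < d, IsRegularMod (partialIdeal x i) (x i)) {r : ℕ → R}
    (h : ∑ j ∈ Finset.range d, r j * x j = 0) : ∀ j < d, r j ∈ partialIdeal x d := by
  induction d generalizing r with
  | zero => simp
  | succ d ih =>
    rw [Finset.sum_range_succ] at h
    have h1 : r d ∈ partialIdeal x d := by
      apply hreg d (Nat.lt_succ_self d)
      refine mem_partialIdeal_iff.2 ⟨fun j => - r j, ?_⟩
      simp only [neg_mul, Finset.sum_neg_distrib]
      linear_combination h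
    obtain ⟨s, hs⟩ := mem_partialIdeal_iff.1 h1
    have h2 : ∑ j ∈ Finset.range d, (r j + s j * x d) * x j = 0 := by
      have : ∑ j ∈ Finset.range d, (r j + s j * x d) * x j =
          ∑ j ∈ Finset.range d, r j * x j + x d * ∑ j ∈ Finset.range d, s j * x j := by
        rw [Finset.mul_sum, ← Finset.sum_add_distrib]
        exact Finset.sum_congr rfl fun j _ => by ring
      rw [this, ← hs]
      linear_combination h
    intro j hj
    rcases Nat.lt_succ_iff_lt_or_eq.1 hj with hj | rfl
    · have h3 := ih (fun i hi => hreg i (by omega)) h2 j hj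
      have : r j = (r j + s j * x d) - s j * x d := by ring
      rw [this]
      exact Ideal.sub_mem _ (partialIdeal_mono x (Nat.le_succ d) h3)
        (Ideal.mul_mem_left _ _ (mem_partialIdeal x (Nat.lt_succ_self d)))
    · exact partialIdeal_mono x (Nat.le_succ _) h1

lemma mem_of_mul_mem_mul_partialIdeal_sup {x : ℕ → R} {d i : ℕ} (hi : i < d)
    (hreg : ∀ i < d, IsRegularMod (partialIdeal x i) (x i)) {A : Ideal R}
    (hA : partialIdeal x d ≤ A) {c : R}
    (h : x i * c ∈ A * partialIdeal x d ⊔ partialIdeal x i) : c ∈ A := by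
  classical
  obtain ⟨u, hu, v, hv, huv⟩ := Submodule.mem_sup.1 h
  obtain ⟨a, ha, rfl⟩ := mem_mul_partialIdeal.1 hu
  obtain ⟨b, rfl⟩ := mem_partialIdeal_iff.1 hv
  have hb : ∑ j ∈ Finset.range i, b j * x j =
      ∑ j ∈ Finset.range d, (if j < i then b j else 0) * x j := by
    rw [← Finset.sum_subset (Finset.range_subset_range.2 hi.le)]
    · exact Finset.sum_congr rfl fun j hj => by rw [if_pos (Finset.mem_range.1 hj)]
    · intro j _ hj
      rw [if_neg (by simpa using hj), zero_mul]
  have hc : x i * c = ∑ j ∈ Finset.range d, (if j = i then c else 0) * x j := by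
    rw [Finset.sum_eq_single_of_mem i (Finset.mem_range.2 hi)]
    · rw [if_pos rfl, mul_comm]
    · intro j _ hj
      rw [if_neg hj, zero_mul]
  have h0 : ∑ j ∈ Finset.range d,
      (a j + (if j < i then b j else 0) - (if j = i then c else 0)) * x j = 0 := by
    simp only [sub_mul, add_mul, Finset.sum_sub_distrib, Finset.sum_add_distrib]
    rw [← hb, ← hc, huv, sub_self]
  have h1 := coeff_mem_of_sum_eq_zero hreg h0 i hi
  rw [if_neg (lt_irrefl i), if_pos rfl, add_zero] at h1
  have : c = a i - (a i - c) := by ring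
  rw [this]
  exact A.sub_mem (ha i) (hA h1)

/-- If `x` is a regular sequence of length `d` with ideal `J ≤ A`, then
`ℓ(R/AJ) = ℓ(R/J) + d ℓ(R/A)`. -/
lemma colength_mul_partialIdeal {x : ℕ → R} {d : ℕ}
    (hreg : ∀ i < d, IsRegularMod (partialIdeal x i) (x i)) {A : Ideal R}
    (hA : partialIdeal x d ≤ A) (hfin : FiniteColength (A * partialIdeal x d)) :
    colength (A * partialIdeal x d) = colength (partialIdeal x d) + d * colength A := by
  -- Adjoin the terms of x to AJ one at a time: (AJ + (x₀, …, xᵢ₋₁)) : xᵢ = A, so each contributes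
  -- ℓ(R/A).
  have key : ∀ i ≤ d, colength (A * partialIdeal x d) =
      colength (A * partialIdeal x d ⊔ partialIdeal x i) + i * colength A := by
    intro i
    induction i with
    | zero => simp
    | succ i ih =>
      intro hi
      rw [ih (by omega), colength_eq_colon_add (C := A) (x := x i) (hfin.mono le_sup_left),
        sup_assoc, ← partialIdeal_succ]
      · push_cast; ring
      · intro c
        refine ⟨fun hc => Ideal.mem_sup_left ?_,
          mem_of_mul_mem_mul_partialIdeal_sup (by omega) hreg hA⟩
        rw [mul_comm (x i) c]
        exact Ideal.mul_mem_mul hc (mem_partialIdeal x (by omega))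
  rw [key d le_rfl, sup_eq_right.2 Ideal.mul_le_right]

lemma isRegularMod_partialIdeal [IsLocalRing R] [IsNoetherianRing R] {x : ℕ → R} {d : ℕ}
    (hchain : HasRegularChain d (⊥ : Ideal R)) (hx : ∀ i < d, x i ∈ maximalIdeal R)
    (hm : maximalIdeal R ≤ (partialIdeal x d).radical) :
    ∀ i < d, IsRegularMod (partialIdeal x i) (x i) := by
  classical
  suffices h : ∀ i ≤ d, HasRegularChain (d - i) (partialIdeal x i) ∧
      (i < d → IsRegularMod (partialIdeal x i) (x i)) from fun i hi => (h i hi.le).2 hi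
  have step : ∀ i < d, HasRegularChain (d - i) (partialIdeal x i) →
      IsRegularMod (partialIdeal x i) (x i) := by
    intro i hi h
    -- The d - i - 1 terms after `x i`, fewer than the remaining depth d - i, complete the ideal to
    -- one with radical the maximal ideal.
    refine h.isRegularMod (s := (Finset.Ioo i d).image x) ?_ ?_ ?_
    · refine Finset.card_image_le.trans_lt ?_
      rw [Nat.card_Ioo]
      omega
    · intro c hc
      obtain ⟨j, hj, rfl⟩ := Finset.mem_image.1 (Finset.mem_coe.1 hc)
      exact hx j (Finset.mem_Ioo.1 hj).2
    · refine hm.trans (Ideal.radical_mono (Ideal.span_le.2 ?_))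
      rintro _ ⟨j, hj, rfl⟩
      rw [← partialIdeal_succ]
      by_cases hji : j < i + 1
      · exact Ideal.mem_sup_left (mem_partialIdeal x hji)
      · exact Ideal.mem_sup_right (Ideal.subset_span (Finset.mem_coe.2
          (Finset.mem_image_of_mem x (Finset.mem_Ioo.2 ⟨by omega, hj⟩))))
  intro i
  induction i with
  | zero => exact fun _ => ⟨by simpa using hchain, fun h0 => step 0 h0 (by simpa using hchain)⟩
  | succ i ih =>
    intro hi
    obtain ⟨h1, h2⟩ := ih (by omega)
    have h3 : HasRegularChain (d - (i + 1)) (partialIdeal x (i + 1)) := by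
      rw [partialIdeal_succ]
      exact HasRegularChain.sup_span (by rwa [show d - (i + 1) + 1 = d - i by omega])
        (hx i (by omega)) (h2 (by omega))
    exact ⟨h3, fun hlt => step (i + 1) hlt h3⟩

end PartialIdeal

/-! ### Cayley–Hamilton with a bound on the degree. -/

section CayleyHamilton

/-- Cayley–Hamilton for an endomorphism that preserves the span of a finite set `T`, with a bound
for the degree by the cardinality of `T`. -/
lemma exists_monic_natDegree_le_card {S E : Type*} [CommRing S] [AddCommGroup E] [Module S E]
    (f : Module.End S E) (T : Finset E)
    (hT : ∀ t ∈ T, f t ∈ Submodule.span S (T : Set E)) :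
    ∃ p : Polynomial S, p.Monic ∧ p.natDegree ≤ T.card ∧
      ∀ e ∈ Submodule.span S (T : Set E),
        ∑ i ∈ Finset.range (p.natDegree + 1), p.coeff i • (f ^ i) e = 0 := by
  classical
  set W := Submodule.span S (T : Set E) with hW
  have hf : ∀ w ∈ W, f w ∈ W := by
    have : W ≤ W.comap f := Submodule.span_le.2 fun t ht => hT t ht
    exact fun w hw => this hw
  have hWfin : Module.Finite S W := Module.Finite.span_finset S T
  obtain ⟨p, hp, hdeg, hzero⟩ :=
    LinearMap.exists_monic_and_natDegree_eq_and_aeval_eq_zero S (f.restrict hf)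
  refine ⟨p, hp, ?_, ?_⟩
  · rw [hdeg]
    -- The degree equals the least number of generators of W, and T pulled back to W generates it.
    have htop : (⊤ : Submodule S W) = Submodule.span S ((fun w : W => (w : E)) ⁻¹' (T : Set E)) :=
      (Submodule.span_span_coe_preimage).symm
    have hfin : ((fun w : W => (w : E)) ⁻¹' (T : Set E)).Finite :=
      T.finite_toSet.preimage Subtype.val_injective.injOn
    rw [htop]
    refine (Submodule.spanFinrank_span_le_ncard_of_finite hfin).trans ?_
    rw [← Set.ncard_coe_finset T]
    refine Set.ncard_le_ncard_of_injOn (fun w : W => (w : E)) (fun w hw => hw)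
      Subtype.val_injective.injOn T.finite_toSet
  · intro e he
    have h1 := congrArg (fun g : Module.End S W => ((g ⟨e, he⟩ : W) : E)) hzero
    simp only [LinearMap.zero_apply, ZeroMemClass.coe_zero] at h1
    rw [← h1, Polynomial.aeval_eq_sum_range]
    simp only [LinearMap.sum_apply, LinearMap.smul_apply, Submodule.coe_sum, Submodule.coe_smul]
    refine Finset.sum_congr rfl fun i _ => ?_
    rw [Module.End.pow_restrict]
    rfl

end CayleyHamilton

/-! ### Rossi's bound through modules over the Rees algebra. -/

section ReesModule

open Polynomial

variable {R : Type*} [CommRing R]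

lemma pow_mul_le_of_mul_le {K : Ideal R} {B : ℕ → Ideal R} (hB : ∀ n, K * B n ≤ B (n + 1))
    (i n : ℕ) : K ^ i * B n ≤ B (n + i) := by
  induction i with
  | zero => simp
  | succ i ih =>
    rw [pow_succ', mul_assoc]
    exact (Ideal.mul_mono_right ih).trans (hB _)

/-- The graded submodule `⊕ Bₙ Xⁿ` of `R[X]` over the Rees algebra of `K`. -/
def gradedSubmodule (K : Ideal R) (B : ℕ → Ideal R) (hB : ∀ n, K * B n ≤ B (n + 1)) :
    Submodule (reesAlgebra K) R[X] where
  carrier := {p | ∀ n, p.coeff n ∈ B n}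
  add_mem' hp hq n := by
    rw [coeff_add]
    exact (B n).add_mem (hp n) (hq n)
  zero_mem' n := by
    rw [coeff_zero]
    exact (B n).zero_mem
  smul_mem' s p hp n := by
    rw [Subalgebra.smul_def, smul_eq_mul, coeff_mul]
    refine Ideal.sum_mem _ fun ij hij => ?_
    have h := pow_mul_le_of_mul_le hB ij.1 ij.2
      (Ideal.mul_mem_mul ((mem_reesAlgebra_iff K _).1 s.2 ij.1) (hp ij.2))
    rwa [add_comm, Finset.HasAntidiagonal.mem_antidiagonal.1 hij] at h

lemma monomial_mem_gradedSubmodule {K : Ideal R} {B : ℕ → Ideal R}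
    {hB : ∀ n, K * B n ≤ B (n + 1)} {n : ℕ} {c : R} (hc : c ∈ B n) :
    monomial n c ∈ gradedSubmodule K B hB := by
  intro m
  rw [coeff_monomial]
  split_ifs with h
  · exact h ▸ hc
  · exact (B m).zero_mem

/-- The sequence `0, 0, K G₁ + Q, K G₂ + Q, …`. -/
def shiftedIdeal (K Q : Ideal R) (G : ℕ → Ideal R) : ℕ → Ideal R
  | 0 => ⊥
  | 1 => ⊥
  | n + 2 => K * G (n + 1) ⊔ Q

/-- Used with L = K for the Rees module structure and with L = I for stability under multiplication
by bX. The latter is why `G 1` cannot be placed in degree one: I `G 1` need not lie in K `G 1` + Q.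
-/
lemma mul_shiftedIdeal_le {K Q : Ideal R} {G : ℕ → Ideal R} {L : Ideal R}
    (hL : ∀ n, L * G n ≤ G (n + 1)) (n : ℕ) :
    L * shiftedIdeal K Q G n ≤ shiftedIdeal K Q G (n + 1) := by
  match n with
  | 0 => simp [shiftedIdeal]
  | 1 => simp [shiftedIdeal]
  | n + 2 =>
    simp only [shiftedIdeal, Ideal.mul_sup]
    refine sup_le_sup ?_ Ideal.mul_le_right
    rw [mul_left_comm]
    exact Ideal.mul_mono_right (hL _)

/-- The set `T` generates `⊕ Fₙ` up to degree `m + 1` modulo `K G₁ + Q, K G₂ + Q, …`, and modulo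
`G₁` in degree one. -/
def GeneratesUpTo (K Q : Ideal R) (G F : ℕ → Ideal R) (hK : ∀ n, K * G n ≤ G (n + 1))
    (T : Set R[X]) (m : ℕ) : Prop :=
  (∀ c ∈ F 1, ∃ g ∈ G 1, monomial 1 (c - g) ∈ Submodule.span (reesAlgebra K) T) ∧
  ∀ n < m, ∀ c ∈ F (n + 2), monomial (n + 2) c ∈
    Submodule.span (reesAlgebra K) T ⊔
      gradedSubmodule K (shiftedIdeal K Q G) (mul_shiftedIdeal_le hK)

lemma monomial_mem_span_of_mem_span {K : Ideal R} {t : Set R} {T : Set R[X]} {n : ℕ}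
    (h : ∀ c ∈ t, monomial n c ∈ Submodule.span (reesAlgebra K) T) {c : R}
    (hc : c ∈ Ideal.span t) : monomial n c ∈ Submodule.span (reesAlgebra K) T := by
  induction hc using Submodule.span_induction with
  | mem c hc => exact h c hc
  | zero => simp
  | add u v _ _ hu hv =>
    rw [map_add]
    exact Submodule.add_mem _ hu hv
  | smul r u _ hu =>
    have : monomial n (r • u) = (algebraMap R (reesAlgebra K) r) • monomial n u := by
      rw [Subalgebra.smul_def, smul_eq_mul, smul_eq_mul]
      exact C_mul_monomial.symm
    rw [this]
    exact Submodule.smul_mem _ _ hu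

lemma GeneratesUpTo.succ {K Q : Ideal R} {G F : ℕ → Ideal R} {hK : ∀ n, K * G n ≤ G (n + 1)}
    {T T' : Set R[X]} {m : ℕ} (h : GeneratesUpTo K Q G F hK T m) (hT : T ⊆ T') {t : Set R}
    (ht : F (m + 2) ≤ K * F (m + 1) ⊔ Q ⊔ Ideal.span t)
    (htT : ∀ c ∈ t, monomial (m + 2) c ∈ T') : GeneratesUpTo K Q G F hK T' (m + 1) := by
  have hmono := Submodule.span_mono (R := reesAlgebra K) hT
  refine ⟨fun c hc => ?_, fun n hn c hc => ?_⟩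
  · obtain ⟨g, hg, hcg⟩ := h.1 c hc
    exact ⟨g, hg, hmono hcg⟩
  rcases Nat.lt_succ_iff_lt_or_eq.1 hn with hn | rfl
  · exact sup_le_sup_right hmono _ (h.2 n hn c hc)
  obtain ⟨v, hv, w, hw, rfl⟩ := Submodule.mem_sup.1 (ht hc)
  obtain ⟨u, hu, q, hq, rfl⟩ := Submodule.mem_sup.1 hv
  rw [map_add, map_add]
  refine Submodule.add_mem _ (Submodule.add_mem _ ?_ ?_) ?_
  · clear hv hc
    induction hu using Submodule.mul_induction_on' with
    | mem_mul_mem κ hκ f hf =>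
      have hmul : ∀ g, monomial (n + 2) (κ * g) =
          (⟨monomial 1 κ, reesAlgebra.monomial_mem.2 (by simpa using hκ)⟩ : reesAlgebra K) •
            monomial (n + 1) g := by
        intro g
        rw [Subalgebra.smul_def, smul_eq_mul, monomial_mul_monomial,
          show 1 + (n + 1) = n + 2 by omega]
      rcases n with _ | n
      · obtain ⟨g, hg, hfg⟩ := h.1 f hf
        have : κ * f = κ * (f - g) + κ * g := by ring
        rw [this, map_add]
        refine Submodule.add_mem_sup ?_ (monomial_mem_gradedSubmodule ?_)
        · rw [hmul]
          exact Submodule.smul_mem _ _ (hmono hfg)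
        · exact Ideal.mem_sup_left (Ideal.mul_mem_mul hκ hg)
      · rw [hmul]
        exact Submodule.smul_mem _ _ (sup_le_sup_right hmono _ (h.2 n (by omega) f hf))
    | add u _ v _ hu hv =>
      rw [map_add]
      exact Submodule.add_mem _ hu hv
  · exact Submodule.mem_sup_right (monomial_mem_gradedSubmodule (Ideal.mem_sup_right hq))
  · exact Submodule.mem_sup_left (monomial_mem_span_of_mem_span
      (fun c hc => Submodule.subset_span (htT c hc)) hw)

/-- Length counts new generators: ℓ(F₁/G₁) in degree one, and ℓ(Fₙ₊₂/(KFₙ₊₁ + Q)) in degree n + 2.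
Passing to F₁/G₁ is harmless because K G₁ is zero in degree two of the quotient. -/
lemma exists_generatesUpTo {K Q : Ideal R} {G F : ℕ → Ideal R}
    (hK : ∀ n, K * G n ≤ G (n + 1)) (hGF : G 1 ≤ F 1) (hKF : ∀ n, K * F n ≤ F (n + 1))
    (hQF : ∀ n, Q ≤ F n) (hfin : ∀ n, FiniteColength (K * F n ⊔ Q))
    (hfinG : FiniteColength (G 1)) (m : ℕ) :
    ∃ T : Finset R[X],
      (T.card : ℤ) ≤ colength (G 1) - colength (F 1) +
        ∑ n ∈ Finset.range m, (colength (K * F (n + 1) ⊔ Q) - colength (F (n + 2))) ∧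
      (∀ p ∈ T, ∃ n, ∃ h ∈ F (n + 1), p = monomial (n + 1) h) ∧
      GeneratesUpTo K Q G F hK (T : Set R[X]) m := by
  classical
  induction m with
  | zero =>
    obtain ⟨t, ht, hs⟩ := exists_finset_sup_span_eq hfinG hGF
    refine ⟨t.image (monomial 1), ?_, ?_, ?_, by simp⟩
    · rw [Finset.sum_range_zero, add_zero]
      exact le_trans (by exact_mod_cast Finset.card_image_le) ht
    · intro p hp
      obtain ⟨h, hh, rfl⟩ := Finset.mem_image.1 hp
      refine ⟨0, h, ?_, rfl⟩
      rw [zero_add, ← hs]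
      exact Ideal.mem_sup_right (Ideal.subset_span hh)
    · intro c hc
      rw [← hs] at hc
      obtain ⟨g, hg, w, hw, rfl⟩ := Submodule.mem_sup.1 hc
      refine ⟨g, hg, ?_⟩
      rw [add_sub_cancel_left]
      refine monomial_mem_span_of_mem_span (fun c hc => Submodule.subset_span ?_) hw
      exact Finset.mem_coe.2 (Finset.mem_image_of_mem _ hc)
  | succ m ih =>
    obtain ⟨T, hcard, hmem, hgen⟩ := ih
    obtain ⟨t, ht, hs⟩ := exists_finset_sup_span_eq (hfin (m + 1)) (sup_le (hKF (m + 1)) (hQF _))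
    refine ⟨T ∪ t.image (monomial (m + 2)), ?_, ?_, ?_⟩
    · rw [Finset.sum_range_succ]
      have h1 := Finset.card_union_le T (t.image (monomial (m + 2)))
      have h2 : (t.image (monomial (m + 2))).card ≤ t.card := Finset.card_image_le
      have h3 : m + 1 + 1 = m + 2 := rfl
      rw [h3] at ht
      omega
    · intro p hp
      rcases Finset.mem_union.1 hp with hp | hp
      · exact hmem p hp
      · obtain ⟨h, hh, rfl⟩ := Finset.mem_image.1 hp
        refine ⟨m + 1, h, ?_, rfl⟩
        rw [← hs]
        exact Ideal.mem_sup_right (Ideal.subset_span hh)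
    · refine hgen.succ ?_ hs.ge ?_
      · exact fun p hp => Finset.mem_coe.2 (Finset.mem_union_left _ hp)
      · exact fun c hc => Finset.mem_coe.2
          (Finset.mem_union_right _ (Finset.mem_image_of_mem _ hc))

/-- Rossi's bound: if `⊕_{n ≥ 1} Fₙ` needs at most `k` generators over the Rees algebra of `K`
modulo `⊕ K^{n-1} G₁ + Q`, then `a b^{l+1} ∈ K G_{l+1} + Q` for some `l ≤ k`. -/
lemma exists_mul_pow_mem {K I Q : Ideal R} {G F : ℕ → Ideal R} (hKI : K ≤ I)
    (hI : ∀ n, I * G n ≤ G (n + 1)) (hIF : ∀ n, I * F n ≤ F (n + 1)) (hGF : ∀ n, G n ≤ F n)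
    (hQF : ∀ n, Q ≤ F n) (hfin : ∀ n, FiniteColength (K * F n ⊔ Q))
    (hfinG : FiniteColength (G 1)) {m : ℕ} (hm : ∀ n ≥ m, F (n + 2) ≤ K * F (n + 1) ⊔ Q)
    {a b : R} (ha : a ∈ G 1) (hb : b ∈ I) :
    ∃ l : ℕ, (l : ℤ) ≤ colength (G 1) - colength (F 1) +
        ∑ n ∈ Finset.range m, (colength (K * F (n + 1) ⊔ Q) - colength (F (n + 2))) ∧
      a * b ^ (l + 1) ∈ K * G (l + 1) ⊔ Q := by
  classical
  have hK : ∀ n, K * G n ≤ G (n + 1) := fun n => (Ideal.mul_mono_left hKI).trans (hI n)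
  have hKF : ∀ n, K * F n ≤ F (n + 1) := fun n => (Ideal.mul_mono_left hKI).trans (hIF n)
  obtain ⟨T, hcard, hmem, hgen⟩ := exists_generatesUpTo hK (hGF 1) hKF hQF hfin hfinG m
  have hall : ∀ n, ∀ c ∈ F (n + 2), monomial (n + 2) c ∈
      Submodule.span (reesAlgebra K) (T : Set R[X]) ⊔
        gradedSubmodule K (shiftedIdeal K Q G) (mul_shiftedIdeal_le hK) := by
    have : ∀ j, GeneratesUpTo K Q G F hK (T : Set R[X]) (m + j) := by
      intro j
      induction j with
      | zero => exact hgen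
      | succ j ih =>
        exact ih.succ (t := ∅) subset_rfl ((hm (m + j) (by omega)).trans le_sup_left) (by simp)
    exact fun n => (this (n + 1)).2 n (by omega)
  set N := gradedSubmodule K (shiftedIdeal K Q G) (mul_shiftedIdeal_le hK) with hN
  -- Multiplication by bX raises degrees, so it sends the generators, all of positive degree, into
  -- degrees at least two, where T generates everything modulo N.
  let μ : Module.End (reesAlgebra K) R[X] := LinearMap.mulLeft (reesAlgebra K) (monomial 1 b)
  have hμN : N ≤ N.comap μ := by
    intro p hp n
    rcases n with _ | n
    · have : (μ p).coeff 0 = 0 := by simp [μ, mul_coeff_zero]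
      rw [this]
      exact Ideal.zero_mem _
    · have : (μ p).coeff (n + 1) = b * p.coeff n := by
        simp only [μ, LinearMap.mulLeft_apply]
        rw [← C_mul_X_eq_monomial, mul_assoc, coeff_C_mul, coeff_X_mul]
      rw [this]
      exact mul_shiftedIdeal_le hI n (Ideal.mul_mem_mul hb (hp n))
  let f : Module.End (reesAlgebra K) (R[X] ⧸ N) := N.mapQ N μ hμN
  have hmap : ∀ p, p ∈ Submodule.span (reesAlgebra K) (T : Set R[X]) ⊔ N → N.mkQ p ∈
      Submodule.span (reesAlgebra K) ((T.image N.mkQ : Finset (R[X] ⧸ N)) : Set (R[X] ⧸ N)) := by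
    intro p hp
    obtain ⟨u, hu, v, hv, rfl⟩ := Submodule.mem_sup.1 hp
    rw [map_add, (by simpa using hv : N.mkQ v = 0), add_zero, Finset.coe_image,
      Submodule.span_image]
    exact Submodule.mem_map_of_mem hu
  obtain ⟨p, hp, hdeg, hzero⟩ := exists_monic_natDegree_le_card f (T.image N.mkQ) (by
    intro t ht
    obtain ⟨q, hq, rfl⟩ := Finset.mem_image.1 ht
    obtain ⟨n, h, hh, rfl⟩ := hmem q hq
    have : f (N.mkQ (monomial (n + 1) h)) = N.mkQ (monomial (n + 2) (b * h)) := by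
      change N.mkQ (monomial 1 b * monomial (n + 1) h) = _
      rw [monomial_mul_monomial, show 1 + (n + 1) = n + 2 by omega]
    rw [this]
    exact hmap _ (hall n _ (hIF _ (Ideal.mul_mem_mul hb hh))))
  refine ⟨p.natDegree, ?_, ?_⟩
  · refine le_trans ?_ hcard
    exact_mod_cast hdeg.trans Finset.card_image_le
  have hbG : ∀ i, a * b ^ i ∈ G (i + 1) := by
    intro i
    induction i with
    | zero => simpa using ha
    | succ i ih =>
      have : a * b ^ (i + 1) = b * (a * b ^ i) := by ring
      rw [this]
      exact hI _ (Ideal.mul_mem_mul hb ih)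
  -- The relation is evaluated at abX² and not at aX: in degree one, T generates only modulo `G 1`,
  -- which contains a.
  have hab := hzero _ (hmap _ (hall 0 (a * b) (hGF 2 (by simpa using hbG 1))))
  have hpow : ∀ i v, (f ^ i) (N.mkQ v) = N.mkQ (monomial i (b ^ i) * v) := by
    intro i
    induction i with
    | zero => intro v; simp
    | succ i ih =>
      intro v
      rw [pow_succ', Module.End.mul_apply, ih]
      change N.mkQ (monomial 1 b * (monomial i (b ^ i) * v)) = _
      rw [← mul_assoc, monomial_mul_monomial, add_comm 1 i, pow_succ' b i]
  have hsum : N.mkQ (∑ i ∈ Finset.range (p.natDegree + 1),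
      p.coeff i • (monomial i (b ^ i) * monomial (0 + 2) (a * b))) = 0 := by
    rw [map_sum, ← hab]
    refine Finset.sum_congr rfl fun i _ => ?_
    rw [hpow, map_smul]
  rw [Submodule.mkQ_apply, Submodule.Quotient.mk_eq_zero] at hsum
  -- With l the degree of p, the monic term contributes abˡ⁺¹ to the coefficient of Xˡ⁺². For i < l
  -- the coefficient of p contributes an element of Kˡ⁻ⁱ times abⁱ⁺¹ ∈ Gᵢ₊₂, which lies in K Gₗ₊₁.
  have hcoeff := hsum (p.natDegree + 2)
  rw [finsetSum_coeff, Finset.sum_range_succ] at hcoeff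
  have hterm : ∀ i ≤ p.natDegree, (p.coeff i • (monomial i (b ^ i) * monomial (0 + 2) (a * b))
      : R[X]).coeff (p.natDegree + 2) =
      (p.coeff i : R[X]).coeff (p.natDegree - i) * (a * b ^ (i + 1)) := by
    intro i hi
    rw [Subalgebra.smul_def, smul_eq_mul, monomial_mul_monomial,
      show p.natDegree + 2 = (p.natDegree - i) + (i + (0 + 2)) by omega, coeff_mul_monomial]
    ring
  rw [hterm _ le_rfl, hp.coeff_natDegree, Nat.sub_self] at hcoeff
  simp only [OneMemClass.coe_one, coeff_one_zero, one_mul] at hcoeff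
  refine (Ideal.add_mem_iff_right _ (Ideal.sum_mem _ fun i hi => ?_)).1 hcoeff
  have hi' := Finset.mem_range.1 hi
  rw [hterm i hi'.le]
  refine Ideal.mem_sup_left ?_
  obtain ⟨j, hj⟩ : ∃ j, p.natDegree - i = j + 1 := ⟨p.natDegree - i - 1, by omega⟩
  have h1 := Ideal.mul_mem_mul ((mem_reesAlgebra_iff K _).1 (p.coeff i).2 (p.natDegree - i))
    (hbG (i + 1))
  rw [hj, pow_succ', mul_assoc] at h1
  have h2 := Ideal.mul_mono_right (I := K) (pow_mul_le_of_mul_le hK j (i + 1 + 1)) h1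
  rwa [show i + 1 + 1 + j = p.natDegree + 1 by omega, ← hj] at h2

end ReesModule

/-! ### Ratliff–Rush closure, the two-dimensional case, and Sally's machine. -/

section RatliffRush

variable {R : Type*} [CommRing R]

/-- Such a sequence is a block of ones followed by zeros, so its sum is at most the length of the
block. -/
lemma eq_one_of_le_sum {u : ℕ → ℤ} (h0 : ∀ n, 0 ≤ u n) (h1 : ∀ n, u n ≤ 1)
    (hz : ∀ n, u n = 0 → u (n + 1) = 0) {l N : ℕ}
    (hl : (l : ℤ) ≤ ∑ n ∈ Finset.range N, u n) : ∀ n < l, u n = 1 := by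
  intro n hn
  by_contra hne
  have hn0 : u n = 0 := by have := h0 n; have := h1 n; omega
  have hzero : ∀ j, u (n + j) = 0 := by
    intro j
    induction j with
    | zero => exact hn0
    | succ j ih => exact hz _ ih
  have : ∑ i ∈ Finset.range N, u i ≤ ∑ i ∈ Finset.range N, if i < n then (1 : ℤ) else 0 := by
    refine Finset.sum_le_sum fun i _ => ?_
    split_ifs with hi
    · exact h1 i
    · obtain ⟨j, rfl⟩ := Nat.exists_eq_add_of_le (not_lt.1 hi)
      exact (hzero j).le
  rw [← Finset.sum_filter, Finset.sum_const, nsmul_eq_mul, mul_one] at this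
  have hcard : ((Finset.range N).filter (· < n)).card ≤ n := by
    calc ((Finset.range N).filter (· < n)).card ≤ (Finset.range n).card :=
          Finset.card_le_card fun i hi => Finset.mem_range.2 (Finset.mem_filter.1 hi).2
      _ = n := Finset.card_range n
  omega

/-- The Ratliff–Rush closure `⋃ₖ (Gₙ₊ₖ : xᵏ)` of a filtration with respect to `x`. -/
def ratliffRush (G : ℕ → Ideal R) (x : R) (hx : ∀ n, ∀ c ∈ G n, x * c ∈ G (n + 1)) (n : ℕ) :
    Ideal R where
  carrier := {c | ∃ k, x ^ k * c ∈ G (n + k)}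
  zero_mem' := ⟨0, by simp⟩
  smul_mem' r c := by
    rintro ⟨k, hk⟩
    refine ⟨k, ?_⟩
    rw [smul_eq_mul, mul_left_comm]
    exact (G _).mul_mem_left _ hk
  add_mem' {c c'} := by
    have hpow : ∀ j n, ∀ c ∈ G n, x ^ j * c ∈ G (n + j) := by
      intro j
      induction j with
      | zero => simp
      | succ j ih =>
        intro n c hc
        rw [pow_succ', mul_assoc]
        exact hx _ _ (ih n c hc)
    rintro ⟨k, hk⟩ ⟨k', hk'⟩
    refine ⟨k + k', ?_⟩
    have h1 := hpow k' _ _ hk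
    have h2 := hpow k _ _ hk'
    rw [← mul_assoc, ← pow_add] at h1 h2
    rw [mul_add]
    refine (G _).add_mem ?_ ?_
    · rwa [add_comm k' k, add_assoc] at h1
    · rwa [add_assoc, add_comm k' k] at h2

lemma mem_ratliffRush {G : ℕ → Ideal R} {x : R} {hx : ∀ n, ∀ c ∈ G n, x * c ∈ G (n + 1)} {n : ℕ}
    {c : R} : c ∈ ratliffRush G x hx n ↔ ∃ k, x ^ k * c ∈ G (n + k) := Iff.rfl

lemma le_ratliffRush {G : ℕ → Ideal R} {x : R} (hx : ∀ n, ∀ c ∈ G n, x * c ∈ G (n + 1)) (n : ℕ) :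
    G n ≤ ratliffRush G x hx n := fun c hc => ⟨0, by simpa using hc⟩

lemma mul_mem_ratliffRush_succ {G : ℕ → Ideal R} {x : R}
    (hx : ∀ n, ∀ c ∈ G n, x * c ∈ G (n + 1)) {n : ℕ} {c : R} :
    x * c ∈ ratliffRush G x hx (n + 1) ↔ c ∈ ratliffRush G x hx n := by
  rw [mem_ratliffRush, mem_ratliffRush]
  constructor
  · rintro ⟨k, hk⟩
    refine ⟨k + 1, ?_⟩
    rwa [pow_succ, mul_assoc, ← add_assoc, add_right_comm]
  · rintro ⟨k, hk⟩
    refine ⟨k, ?_⟩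
    have := hx _ _ hk
    rw [mul_left_comm, add_right_comm]
    exact this

lemma mem_of_pow_mul_mem {G : ℕ → Ideal R} {x : R} {N : ℕ}
    (hsup : ∀ n ≥ N, ∀ c, x * c ∈ G (n + 1) → c ∈ G n) {n : ℕ} (hn : N ≤ n) (k : ℕ) {c : R}
    (h : x ^ k * c ∈ G (n + k)) : c ∈ G n := by
  induction k with
  | zero => simpa using h
  | succ k ih =>
    apply ih
    rw [pow_succ', mul_assoc] at h
    exact hsup (n + k) (by omega) _ h

lemma ratliffRush_eq {G : ℕ → Ideal R} {x : R} (hx : ∀ n, ∀ c ∈ G n, x * c ∈ G (n + 1)) {N : ℕ}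
    (hsup : ∀ n ≥ N, ∀ c, x * c ∈ G (n + 1) → c ∈ G n) {n : ℕ} (hn : N ≤ n) :
    ratliffRush G x hx n = G n :=
  le_antisymm (fun _ ⟨k, hk⟩ => mem_of_pow_mul_mem hsup hn k hk) (le_ratliffRush hx n)

lemma mul_ratliffRush_le {G : ℕ → Ideal R} {x : R} (hx : ∀ n, ∀ c ∈ G n, x * c ∈ G (n + 1))
    {I : Ideal R} (hI : ∀ n, I * G n ≤ G (n + 1)) (n : ℕ) :
    I * ratliffRush G x hx n ≤ ratliffRush G x hx (n + 1) := by
  refine Ideal.mul_le.2 fun b hb c hc => ?_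
  obtain ⟨k, hk⟩ := hc
  refine ⟨k, ?_⟩
  rw [mul_left_comm, add_right_comm]
  exact hI _ (Ideal.mul_mem_mul hb hk)

/-- Modulo Q + (x) the product (x, y)A becomes yA with y regular, so its colon by y is A + (x). -/
lemma colength_mul_sup_sup {Q A : Ideal R} {x y : R}
    (hy : IsRegularMod (Q ⊔ Ideal.span {x}) y) (hQA : Q ≤ A)
    (hfin : FiniteColength (Ideal.span {x, y} * A ⊔ Q)) :
    colength (Ideal.span {x, y} * A ⊔ Q ⊔ Ideal.span {x}) =
      colength (A ⊔ Ideal.span {x}) + colength (Ideal.span {x, y} ⊔ Q) := by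
  have hspan : Ideal.span {x, y} = Ideal.span {x} ⊔ Ideal.span {y} := Ideal.span_insert x {y}
  rw [colength_eq_colon_add (C := A ⊔ Ideal.span {x}) (x := y) (hfin.mono le_sup_left)]
  · congr 2
    rw [sup_assoc, sup_assoc, ← hspan, sup_comm Q,
      sup_eq_right.2 (Ideal.mul_le_left.trans le_sup_left)]
  · intro c
    constructor
    · intro hc
      obtain ⟨α, hα, t, ht, rfl⟩ := Submodule.mem_sup.1 hc
      rw [mul_add]
      refine Submodule.add_mem_sup (Ideal.mem_sup_left (Ideal.mul_mem_mul ?_ hα))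
        (Ideal.mul_mem_left _ _ ht)
      exact Ideal.subset_span (by simp)
    · intro hc
      have hle : Ideal.span {x, y} * A ⊔ Q ⊔ Ideal.span {x} ≤
          (Q ⊔ Ideal.span {x}) ⊔ Ideal.span {y} * A := by
        rw [hspan, Ideal.sup_mul]
        refine sup_le (sup_le (sup_le ?_ le_sup_right) ?_) ?_
        · exact Ideal.mul_le_left.trans (le_sup_right.trans le_sup_left)
        · exact le_sup_left.trans le_sup_left
        · exact le_sup_right.trans le_sup_left
      obtain ⟨u, hu, v, hv, huv⟩ := Submodule.mem_sup.1 (hle hc)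
      obtain ⟨α, hα, rfl⟩ := Ideal.mem_span_singleton_mul.1 hv
      have h1 : c - α ∈ Q ⊔ Ideal.span {x} := by
        apply hy
        rw [mul_sub, ← huv, add_sub_cancel_right]
        exact hu
      have : c = α + (c - α) := by ring
      rw [this]
      exact Ideal.add_mem _ (Ideal.mem_sup_left hα) (sup_le_sup_right hQA _ h1)

/-- If no new generator is needed in one degree modulo X, multiplying by I shows that none is needed
in the next. -/
lemma sup_span_le_of_eq {I K Q G₁ G₂ G₃ X : Ideal R} (hGI : G₃ ≤ I * G₂ ⊔ Q) (hI : I * G₁ ≤ G₂)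
    (h : K * G₁ ⊔ Q ⊔ X = G₂ ⊔ X) : G₃ ⊔ X ≤ K * G₂ ⊔ Q ⊔ X := by
  refine sup_le (hGI.trans (sup_le ?_ (le_sup_right.trans le_sup_left))) le_sup_right
  have h1 : G₂ ≤ K * G₁ ⊔ Q ⊔ X := h ▸ le_sup_left
  refine (Ideal.mul_mono_right h1).trans ?_
  rw [Ideal.mul_sup, Ideal.mul_sup, mul_left_comm]
  refine sup_le (sup_le ?_ ?_) ?_
  · exact (Ideal.mul_mono_right hI).trans (le_sup_left.trans le_sup_left)
  · exact Ideal.mul_le_right.trans (le_sup_right.trans le_sup_left)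
  · exact Ideal.mul_le_right.trans le_sup_right

/-- In dimension two modulo `Q`, a filtration with `ℓ(Gₙ₊₁ / (x, y) Gₙ) ≤ 1` for `n ≥ 1` whose
members are generated by `(x, y) Gₙ` and the elements `a bⁿ` satisfies `Gₙ₊₁ : x = Gₙ`. -/
theorem mem_of_mul_mem_of_length_le_one {Q I : Ideal R} {G : ℕ → Ideal R} {x y a b : R} {N : ℕ}
    (hG0 : G 0 = ⊤) (hQG : ∀ n, Q ≤ G n) (hI : ∀ n, I * G n ≤ G (n + 1))
    (hGI : ∀ n, G (n + 2) ≤ I * G (n + 1) ⊔ Q) (hxI : x ∈ I) (hyI : y ∈ I)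
    (hregx : IsRegularMod Q x) (hregy : IsRegularMod (Q ⊔ Ideal.span {x}) y)
    (hsup : ∀ n ≥ N, ∀ c, x * c ∈ G (n + 1) → c ∈ G n)
    (hred : ∀ n ≥ N, G (n + 1) ≤ Ideal.span {x, y} * G n ⊔ Q)
    (hfin : ∀ n, FiniteColength (Ideal.span {x, y} * G n ⊔ Q))
    (hv : ∀ n, colength (Ideal.span {x, y} * G (n + 1) ⊔ Q) ≤ colength (G (n + 2)) + 1)
    (ha : a ∈ G 1) (hb : b ∈ I)
    (hgen : ∀ n, G (n + 2) ≤
      Ideal.span {x, y} * G (n + 1) ⊔ Q ⊔ Ideal.span {a * b ^ (n + 1)}) :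
    ∀ n c, x * c ∈ G (n + 1) → c ∈ G n := by
  set K := Ideal.span {x, y} with hKdef
  have hKI : K ≤ I := Ideal.span_le.2 (by
    rintro _ (rfl | rfl)
    · exact hxI
    · exact hyI)
  have hxK : x ∈ K := Ideal.subset_span (by simp)
  have hyK : y ∈ K := Ideal.subset_span (by simp)
  have hKG : ∀ n, K * G n ≤ G (n + 1) := fun n => (Ideal.mul_mono_left hKI).trans (hI n)
  have hKGQ : ∀ n, K * G n ⊔ Q ≤ G (n + 1) := fun n => sup_le (hKG n) (hQG _)
  have hx : ∀ n, ∀ c ∈ G n, x * c ∈ G (n + 1) := fun n c hc => hKG n (Ideal.mul_mem_mul hxK hc)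
  have hfinG : ∀ n, FiniteColength (G n) := by
    rintro (_ | n)
    · exact (hfin 0).mono (by rw [hG0]; exact le_top)
    · exact (hfin n).mono (hKGQ n)
  set F := ratliffRush G x hx with hF
  have hGF : ∀ n, G n ≤ F n := le_ratliffRush hx
  have hQF : ∀ n, Q ≤ F n := fun n => (hQG n).trans (hGF n)
  have hIF : ∀ n, I * F n ≤ F (n + 1) := mul_ratliffRush_le hx hI
  have hKFQ : ∀ n, K * F n ⊔ Q ≤ F (n + 1) := fun n =>
    sup_le ((Ideal.mul_mono_left hKI).trans (hIF n)) (hQF _)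
  have hfinF : ∀ n, FiniteColength (K * F n ⊔ Q) := fun n =>
    (hfin n).mono (sup_le_sup_right (Ideal.mul_mono_right (hGF n)) _)
  have hfinF' : ∀ n, FiniteColength (F n) := fun n => (hfinG n).mono (hGF n)
  have hFeq : ∀ n ≥ N, F n = G n := fun n hn => ratliffRush_eq hx hsup hn
  set e := colength (K ⊔ Q) with he
  set c : ℕ → ℤ := fun n => colength (G n ⊔ Ideal.span {x}) with hc
  set cF : ℕ → ℤ := fun n => colength (F n ⊔ Ideal.span {x}) with hcF
  have hx1 : x ∈ G 1 := by
    have := hx 0 1 (by rw [hG0]; trivial)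
    simpa using this
  have hxle : Ideal.span {x} ≤ G 1 := (Ideal.span_singleton_le_iff_mem _).2 hx1
  have hc1 : c 1 = colength (G 1) := by
    simp only [hc]
    rw [sup_eq_left.2 hxle]
  have hcF1 : cF 1 = colength (F 1) := by
    simp only [hcF]
    rw [sup_eq_left.2 (hxle.trans (hGF 1))]
  have hc0 : c 0 = 0 := by
    simp only [hc]
    rw [hG0, top_sup_eq, colength_top]
  -- the invariants of the closure
  have hFv : ∀ n, colength (K * F n ⊔ Q) - colength (F (n + 1)) = cF n + e - cF (n + 1) := by
    intro n
    have h1 : colength (K * F n ⊔ Q) =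
        colength (F n) + colength (K * F n ⊔ Q ⊔ Ideal.span {x}) := by
      refine colength_eq_colon_add (hfinF n) fun z => ⟨fun hz => ?_, fun hz => ?_⟩
      · exact Ideal.mem_sup_left (Ideal.mul_mem_mul hxK hz)
      · exact (mul_mem_ratliffRush_succ hx).1 (hKFQ n hz)
    have h2 : colength (F (n + 1)) = colength (F n) + colength (F (n + 1) ⊔ Ideal.span {x}) :=
      colength_eq_colon_add (hfinF' _) fun z => (mul_mem_ratliffRush_succ hx).symm
    have h3 := colength_mul_sup_sup hregy (hQF n) (hfinF n)
    rw [← hKdef] at h3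
    simp only [hcF]
    omega
  -- the invariants of the filtration modulo `x`
  have hGx : ∀ n, colength (K * G n ⊔ Q ⊔ Ideal.span {x}) = c n + e := fun n =>
    colength_mul_sup_sup hregy (hQG n) (hfin n)
  have hfinx : ∀ n, FiniteColength (K * G n ⊔ Q ⊔ Ideal.span {x}) := fun n =>
    (hfin n).mono le_sup_left
  have hv0 : ∀ n, 0 ≤ c n + e - c (n + 1) := by
    intro n
    have := colength_anti (hfinx n) (sup_le_sup_right (hKGQ n) (Ideal.span {x}))
    rw [hGx] at this
    simp only [hc] at this ⊢
    omega
  have hcolonK : ∀ n, colength (K * G n ⊔ Q) =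
      colength (colonElem (K * G n ⊔ Q) x) + (c n + e) := by
    intro n
    rw [← hGx n]
    exact colength_eq_colon_add (hfin n) fun _ => mem_colonElem
  have hcolonG : ∀ n, colength (G (n + 1)) = colength (colonElem (G (n + 1)) x) + c (n + 1) :=
    fun n => colength_eq_colon_add (hfinG _) fun _ => mem_colonElem
  have hfincolon : ∀ n, FiniteColength (colonElem (K * G n ⊔ Q) x) := fun n =>
    (hfin n).mono fun z hz => mem_colonElem.2 (Ideal.mul_mem_left _ _ hz)
  have hcolonle : ∀ n, colonElem (K * G n ⊔ Q) x ≤ colonElem (G (n + 1)) x := fun n z hz =>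
    mem_colonElem.2 (hKGQ n (mem_colonElem.1 hz))
  have hv1 : ∀ n, c (n + 1) + e - c (n + 2) ≤ 1 := by
    intro n
    have h1 := hv n
    have h2 := colength_anti (hfincolon (n + 1)) (hcolonle (n + 1))
    have h3 := hcolonK (n + 1)
    have h4 := hcolonG (n + 1)
    have h5 : n + 1 + 1 = n + 2 := rfl
    rw [h5] at h2 h4
    omega
  have hvz : ∀ n, c (n + 1) + e - c (n + 2) = 0 → c (n + 2) + e - c (n + 3) = 0 := by
    intro n hn
    have h1 : K * G (n + 1) ⊔ Q ⊔ Ideal.span {x} = G (n + 2) ⊔ Ideal.span {x} := by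
      refine eq_of_colength_le (hfinx _) (sup_le_sup_right (hKGQ _) _) ?_
      rw [hGx]
      simp only [hc] at hn ⊢
      omega
    have h2 : G (n + 3) ⊔ Ideal.span {x} ≤ K * G (n + 2) ⊔ Q ⊔ Ideal.span {x} :=
      sup_span_le_of_eq (hGI (n + 1)) (hI (n + 1)) h1
    have h3 := colength_anti ((hfinG (n + 3)).mono le_sup_left) h2
    rw [hGx] at h3
    have h4 : 0 ≤ c (n + 2) + e - c (n + 3) := hv0 (n + 2)
    have h5 : c (n + 3) = colength (G (n + 3) ⊔ Ideal.span {x}) := rfl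
    omega
  obtain ⟨l, hl, hab⟩ := exists_mul_pow_mem (m := N) hKI hI hIF hGF hQF hfinF (hfinG 1) (fun n hn => by
    rw [hFeq (n + 2) (by omega), hFeq (n + 1) (by omega)]
    exact hred (n + 1) (by omega)) ha hb
  have hsum : ∀ (u : ℕ → ℤ) (M : ℕ), ∑ n ∈ Finset.range M, (u (n + 1) + e - u (n + 2)) =
      M * e + u 1 - u (M + 1) := by
    intro u M
    induction M with
    | zero => simp
    | succ M ih => rw [Finset.sum_range_succ, ih]; push_cast; ring
  -- Rossi's bound telescopes: the term ℓ(F₁/G₁) corrects the starting value from `cF 1` to `c 1`,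
  -- and the end values agree because F = G from degree N on.
  have hl' : (l : ℤ) ≤ ∑ n ∈ Finset.range N, (c (n + 1) + e - c (n + 2)) := by
    refine hl.trans (le_of_eq ?_)
    rw [Finset.sum_congr rfl fun n _ => hFv (n + 1), hsum c, hsum cF, hc1, hcF1]
    have : cF (N + 1) = c (N + 1) := by
      simp only [hc, hcF]
      rw [hFeq (N + 1) (by omega)]
    rw [this]
    ring
  have hone := eq_one_of_le_sum (u := fun n => c (n + 1) + e - c (n + 2))
    (fun n => hv0 (n + 1)) hv1 hvz hl'
  -- Multiplying abˡ⁺¹ ∈ K `G (l + 1)` + Q by powers of b makes every later extra generator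
  -- redundant.
  have hstable : ∀ n ≥ l, G (n + 2) ≤ K * G (n + 1) ⊔ Q := by
    intro n hn
    refine (hgen n).trans (sup_le le_rfl ((Ideal.span_singleton_le_iff_mem _).2 ?_))
    obtain ⟨j, rfl⟩ := Nat.exists_eq_add_of_le hn
    have h1 : a * b ^ (l + j + 1) = b ^ j * (a * b ^ (l + 1)) := by ring
    have h2 := Ideal.mul_mem_mul (Ideal.pow_mem_pow hb j) hab
    rw [← h1, Ideal.mul_sup, mul_left_comm] at h2
    have h3 := pow_mul_le_of_mul_le hI j (l + 1)
    rw [show l + 1 + j = l + j + 1 by omega] at h3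
    exact (sup_le_sup (Ideal.mul_mono_right h3) Ideal.mul_le_right :
      K * (I ^ j * G (l + 1)) ⊔ I ^ j * Q ≤ K * G (l + j + 1) ⊔ Q) h2
  have hcolon : ∀ n, colonElem (K * G n ⊔ Q) x = colonElem (G (n + 1)) x := by
    intro n
    refine eq_of_colength_le (hfincolon n) (hcolonle n) ?_
    -- The length of G (n + 1) over K G n + Q is its length modulo x plus the length between the two
    -- colons by x. So it suffices that no length is lost modulo x: for n < l the degree n + 2 value
    -- modulo x is one, the maximum; for n ≥ l both vanish.
    suffices h : colength (K * G n ⊔ Q) - colength (G (n + 1)) ≤ c n + e - c (n + 1) by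
      have h3 := hcolonK n
      have h4 := hcolonG n
      omega
    rcases n with _ | n
    · rw [hG0, Ideal.mul_top, ← he, hc0, zero_add, zero_add, hc1]
    · have h5 : n + 1 + 1 = n + 2 := rfl
      rw [h5]
      by_cases hn : n < l
      · have h1 : c (n + 1) + e - c (n + 2) = 1 := hone n hn
        have h2 := hv n
        omega
      · have h1 := colength_anti (hfinG (n + 2)) (hstable n (not_lt.1 hn))
        have h2 := hv0 (n + 1)
        rw [h5] at h2
        omega
  intro n
  induction n with
  | zero => intro z _; rw [hG0]; trivial
  | succ n ih =>
    intro z hz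
    have h1 : x * z ∈ K * G (n + 1) ⊔ Q := by
      have := (hcolon (n + 1)).ge (mem_colonElem.2 hz)
      exact mem_colonElem.1 this
    obtain ⟨u, hu, q, hq, huq⟩ := Submodule.mem_sup.1 h1
    rw [hKdef, Ideal.span_insert, Ideal.sup_mul] at hu
    obtain ⟨u₁, hu₁, u₂, hu₂, rfl⟩ := Submodule.mem_sup.1 hu
    obtain ⟨α, hα, rfl⟩ := Ideal.mem_span_singleton_mul.1 hu₁
    obtain ⟨β, hβ, rfl⟩ := Ideal.mem_span_singleton_mul.1 hu₂
    -- From xz = xα + yβ modulo Q, regularity of y modulo x gives β = xγ. The induction hypothesis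
    -- puts γ in `G n`, and cancelling x gives z = α + yγ modulo Q.
    have h2 : β ∈ Q ⊔ Ideal.span {x} := by
      apply hregy
      have : y * β = -q + x * (z - α) := by linear_combination huq
      rw [this]
      exact Submodule.add_mem_sup (Q.neg_mem hq) (Ideal.mem_span_singleton.2 ⟨_, rfl⟩)
    obtain ⟨q', hq', t, ht, rfl⟩ := Submodule.mem_sup.1 h2
    obtain ⟨γ, rfl⟩ := Ideal.mem_span_singleton.1 ht
    have hγ : γ ∈ G n := by
      apply ih
      have : x * γ = (q' + x * γ) - q' := by ring
      rw [this]
      exact (G _).sub_mem hβ (hQG _ hq')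
    have h3 : z - α - y * γ ∈ Q := by
      apply hregx
      have : x * (z - α - y * γ) = q + y * q' := by linear_combination -huq
      rw [this]
      exact Q.add_mem hq (Q.mul_mem_left _ hq')
    have : z = (z - α - y * γ) + α + y * γ := by ring
    rw [this]
    exact (G _).add_mem ((G _).add_mem (hQG _ h3) hα) (hKG n (Ideal.mul_mem_mul hyK hγ))

/-- Sally's machine: if `Gₙ₊₁ : y = Gₙ` modulo `x` and `Gₙ₊₁ : x = Gₙ` for all large `n`, then
`Gₙ₊₁ : x = Gₙ` for all `n`. -/
theorem mem_of_mul_mem_of_mod {G : ℕ → Ideal R} {x y : R} {N : ℕ} (hG0 : G 0 = ⊤)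
    (hx : ∀ n, ∀ c ∈ G n, x * c ∈ G (n + 1)) (hy : ∀ n, ∀ c ∈ G n, y * c ∈ G (n + 1))
    (hsup : ∀ n ≥ N, ∀ c, x * c ∈ G (n + 1) → c ∈ G n)
    (hmod : ∀ n c, y * c ∈ G (n + 1) ⊔ Ideal.span {x} → c ∈ G n ⊔ Ideal.span {x}) :
    ∀ n c, x * c ∈ G (n + 1) → c ∈ G n := by
  have hypow : ∀ j n, ∀ c ∈ G n, y ^ j * c ∈ G (n + j) := by
    intro j
    induction j with
    | zero => simp
    | succ j ih =>
      intro n c hc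
      rw [pow_succ', mul_assoc]
      exact hy _ _ (ih n c hc)
  have hmodpow : ∀ j n c, y ^ j * c ∈ G (n + j) ⊔ Ideal.span {x} → c ∈ G n ⊔ Ideal.span {x} := by
    intro j
    induction j with
    | zero => simp
    | succ j ih =>
      intro n c hc
      apply ih
      rw [pow_succ', mul_assoc] at hc
      exact hmod _ _ hc
  -- All exponents k are needed at once: writing c = f + xc', the remainder c' satisfies the
  -- hypothesis one degree lower with k + 1 in place of k.
  have key : ∀ n k c, x ^ k * c ∈ G (n + k) → c ∈ G n := by
    intro n
    induction n with
    | zero => intro k c _; rw [hG0]; trivial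
    | succ n ih =>
      intro k c hc
      -- The factor yᴺ moves c into degrees where x is already cancellable; the hypothesis modulo x
      -- then removes it.
      have h1 : y ^ N * c ∈ G (n + 1 + N) := by
        refine mem_of_pow_mul_mem hsup (by omega) k ?_
        rw [mul_left_comm, add_right_comm]
        exact hypow N _ _ hc
      obtain ⟨f, hf, t, ht, rfl⟩ := Submodule.mem_sup.1
        (hmodpow N (n + 1) c (Ideal.mem_sup_left h1))
      obtain ⟨c', rfl⟩ := Ideal.mem_span_singleton.1 ht
      refine (G _).add_mem hf (hx _ _ (ih (k + 1) c' ?_))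
      have hxf : x ^ k * f ∈ G (n + 1 + k) := by
        clear h1 hc ht
        induction k with
        | zero => simpa using hf
        | succ k ihk =>
          rw [pow_succ', mul_assoc]
          exact hx _ _ ihk
      have : x ^ (k + 1) * c' = x ^ k * (f + x * c') - x ^ k * f := by ring
      rw [this, show n + (k + 1) = n + 1 + k by omega]
      exact (G _).sub_mem hc hxf
  intro n c hc
  exact key n 1 c (by simpa using hc)

end RatliffRush

/-! ### Functions of polynomial type and their normalized coefficients. -/

section HilbertCoefficients

/-- The polynomial function `∑ (-1)ⁱ cᵢ C(n + D - i, D - i)`. -/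
def hilbertSum (D : ℕ) (c : ℕ → ℤ) (n : ℕ) : ℤ :=
  ∑ i ∈ Finset.range (D + 1), (-1) ^ i * c i * ((n + (D - i)).choose (D - i) : ℤ)

lemma hilbertSum_zero (c : ℕ → ℤ) (n : ℕ) : hilbertSum 0 c n = c 0 := by
  simp [hilbertSum]

/-- By Pascal's rule the difference operator lowers the degree and keeps all coefficients but the
last. Every induction on D below uses this. -/
lemma hilbertSum_succ (D : ℕ) (c : ℕ → ℤ) (n : ℕ) :
    hilbertSum (D + 1) c (n + 1) = hilbertSum (D + 1) c n + hilbertSum D c (n + 1) := by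
  unfold hilbertSum
  have h : ∑ i ∈ Finset.range (D + 1),
      (-1) ^ i * c i * ((n + 1 + (D + 1 - i)).choose (D + 1 - i) : ℤ) =
      ∑ i ∈ Finset.range (D + 1), (-1) ^ i * c i * ((n + (D + 1 - i)).choose (D + 1 - i) : ℤ) +
      ∑ i ∈ Finset.range (D + 1), (-1) ^ i * c i * ((n + 1 + (D - i)).choose (D - i) : ℤ) := by
    rw [← Finset.sum_add_distrib]
    refine Finset.sum_congr rfl fun i hi => ?_
    have hi' : D + 1 - i = D - i + 1 := by have := Finset.mem_range.1 hi; omega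
    rw [hi', ← mul_add]
    congr 1
    rw [show n + 1 + (D - i + 1) = (n + 1 + (D - i)) + 1 by omega, Nat.choose_succ_succ,
      show n + (D - i + 1) = n + 1 + (D - i) by omega]
    push_cast; ring
  rw [Finset.sum_range_succ _ (D + 1), Finset.sum_range_succ _ (D + 1), h]
  simp only [Nat.sub_self, Nat.choose_zero_right]
  ring

lemma hilbertSum_sub (D : ℕ) (c c' : ℕ → ℤ) (n : ℕ) :
    hilbertSum D (fun i => c i - c' i) n = hilbertSum D c n - hilbertSum D c' n := by
  unfold hilbertSum
  rw [← Finset.sum_sub_distrib]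
  exact Finset.sum_congr rfl fun i _ => by ring

lemma hasHilbertCoeffs_iff {D : ℕ} {H c : ℕ → ℤ} :
    HasHilbertCoeffs D H c ↔ (∀ᶠ n in atTop, H n = hilbertSum D c n) ∧ ∀ i, D < i → c i = 0 :=
  Iff.rfl

lemma eq_zero_of_hilbertSum_eq_zero {D : ℕ} {c : ℕ → ℤ}
    (h : ∀ᶠ n in atTop, hilbertSum D c n = 0) : ∀ i ≤ D, c i = 0 := by
  induction D with
  | zero =>
    obtain ⟨n, hn⟩ := h.exists
    intro i hi
    rw [Nat.le_zero.1 hi, ← hilbertSum_zero c n, hn]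
  | succ D ih =>
    have h1 : ∀ i ≤ D, c i = 0 := by
      apply ih
      obtain ⟨N, hN⟩ := eventually_atTop.1 h
      refine eventually_atTop.2 ⟨N + 1, fun n hn => ?_⟩
      obtain ⟨m, rfl⟩ : ∃ m, n = m + 1 := ⟨n - 1, by omega⟩
      have := hilbertSum_succ D c m
      rw [hN (m + 1) (by omega), hN m (by omega)] at this
      omega
    intro i hi
    rcases Nat.le_succ_iff.1 hi with hi | rfl
    · exact h1 i hi
    · obtain ⟨n, hn⟩ := h.exists
      unfold hilbertSum at hn
      rw [Finset.sum_range_succ, Finset.sum_eq_zero] at hn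
      · simpa using hn
      · intro j hj
        rw [h1 j (Nat.lt_succ_iff.1 (Finset.mem_range.1 hj))]
        ring

lemma HasHilbertCoeffs.unique {D : ℕ} {H c c' : ℕ → ℤ} (h : HasHilbertCoeffs D H c)
    (h' : HasHilbertCoeffs D H c') : c = c' := by
  have h1 : ∀ i ≤ D, c i - c' i = 0 := by
    refine eq_zero_of_hilbertSum_eq_zero (c := fun i => c i - c' i) ?_
    filter_upwards [(hasHilbertCoeffs_iff.1 h).1, (hasHilbertCoeffs_iff.1 h').1] with n hn hn'
    rw [hilbertSum_sub, ← hn, ← hn', sub_self]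
  funext i
  by_cases hi : i ≤ D
  · exact sub_eq_zero.1 (h1 i hi)
  · rw [h.2 i (not_le.1 hi), h'.2 i (not_le.1 hi)]

lemma HasHilbertCoeffs.hilbertCoeff_eq {D : ℕ} {H c : ℕ → ℤ} (h : HasHilbertCoeffs D H c) :
    hilbertCoeff D H = c := by
  have hex : ∃ c, HasHilbertCoeffs D H c := ⟨c, h⟩
  unfold hilbertCoeff
  rw [dif_pos hex]
  exact hex.choose_spec.unique h

/-- Summation of a function of polynomial type. -/
lemma HasHilbertCoeffs.exists_of_succ {D : ℕ} {H H' c : ℕ → ℤ} (h : HasHilbertCoeffs D H' c)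
    (hH : ∀ᶠ n in atTop, H (n + 1) = H n + H' (n + 1)) :
    ∃ c', HasHilbertCoeffs (D + 1) H c' ∧ c' 0 = c 0 := by
  obtain ⟨N, hN⟩ := eventually_atTop.1 (hH.and (hasHilbertCoeffs_iff.1 h).1)
  -- From N on, H and the sum with coefficients c have the same differences, so they differ by the
  -- constant κ, which is absorbed into the coefficient with index D + 1.
  set κ := H N - hilbertSum (D + 1) c N with hκ
  set c' : ℕ → ℤ := fun i => if i = D + 1 then (-1) ^ (D + 1) * κ else c i with hc'
  have hlow : ∀ i ≤ D, c' i = c i := fun i hi => if_neg (by omega)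
  have hsum : ∀ n, hilbertSum (D + 1) c' n = hilbertSum (D + 1) c n + κ := by
    intro n
    unfold hilbertSum
    rw [Finset.sum_range_succ, Finset.sum_range_succ _ (D + 1), h.2 (D + 1) (Nat.lt_succ_self D)]
    have h1 : c' (D + 1) = (-1) ^ (D + 1) * κ := if_pos rfl
    rw [h1, ← mul_assoc, ← mul_pow]
    simp only [Nat.sub_self, Nat.choose_zero_right, mul_zero, zero_mul, add_zero]
    norm_num
    exact Finset.sum_congr rfl fun i hi => by
      rw [hlow i (Nat.lt_succ_iff.1 (Finset.mem_range.1 hi))]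
  refine ⟨c', ⟨eventually_atTop.2 ⟨N, fun n hn => ?_⟩, fun i hi => ?_⟩, hlow 0 (Nat.zero_le _)⟩
  · change H n = hilbertSum (D + 1) c' n
    induction n, hn using Nat.le_induction with
    | base => rw [hsum]; omega
    | succ n hn ih =>
      have h1 := (hN n hn).1
      have h2 := (hN (n + 1) (by omega)).2
      rw [hsum, hilbertSum_succ, h1, ih, h2, hsum]
      ring
  · rw [hc']
    simp only
    rw [if_neg (by omega), h.2 i (by omega)]

lemma hilbertSum_lt_zero_of_neg {D : ℕ} {c : ℕ → ℤ} (h : c 0 < 0) :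
    ∀ᶠ n in atTop, hilbertSum D c n < 0 := by
  induction D with
  | zero => exact Eventually.of_forall fun n => by rwa [hilbertSum_zero]
  | succ D ih =>
    obtain ⟨N, hN⟩ := eventually_atTop.1 ih
    have hle : ∀ j : ℕ, hilbertSum (D + 1) c (N + j) ≤ hilbertSum (D + 1) c N - j := by
      intro j
      induction j with
      | zero => simp
      | succ j ihj =>
        have h1 := hilbertSum_succ D c (N + j)
        have h2 := hN (N + j + 1) (by omega)
        rw [← add_assoc, h1]
        push_cast
        omega
    refine eventually_atTop.2 ⟨N + ((hilbertSum (D + 1) c N).toNat + 1), fun n hn => ?_⟩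
    obtain ⟨j, rfl⟩ := Nat.exists_eq_add_of_le (show N ≤ n by omega)
    have h1 := hle j
    have h2 := Int.self_le_toNat (hilbertSum (D + 1) c N)
    omega

/-- The leading coefficient of a function that is bounded by `M C(n + D - 1, D)` is at most `M`. -/
lemma HasHilbertCoeffs.zero_le_of_le {D : ℕ} {H c : ℕ → ℤ} {M : ℤ}
    (h : HasHilbertCoeffs (D + 1) H c)
    (hle : ∀ᶠ n in atTop, H n ≤ M * ((n + D).choose (D + 1) : ℤ)) : c 0 ≤ M := by
  by_contra hlt
  -- C(n + D, D + 1) = C(n + D + 1, D + 1) - C(n + D, D), so the normalized coefficients of the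
  -- bound are M, M, 0, ….
  have hM : ∀ n : ℕ, 0 < n → M * ((n + D).choose (D + 1) : ℤ) =
      hilbertSum (D + 1) (fun i => if i ≤ 1 then M else 0) n := by
    intro n hn
    obtain ⟨m, rfl⟩ : ∃ m, n = m + 1 := ⟨n - 1, by omega⟩
    unfold hilbertSum
    rw [Finset.sum_eq_add_of_mem 0 1 (by simp) (by simp) (by simp)]
    · simp only [Nat.sub_zero, Nat.add_sub_cancel]
      rw [show m + 1 + (D + 1) = (m + 1 + D) + 1 by omega, Nat.choose_succ_succ]
      simp
      ring
    · intro i _ hi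
      beta_reduce
      rw [if_neg (by omega)]
      ring
  have h1 := hilbertSum_lt_zero_of_neg (D := D + 1)
    (c := fun i => (if i ≤ 1 then M else 0) - c i) (by simp; omega)
  obtain ⟨n, hn1, hn2, hn3, hn0⟩ :=
    (h1.and (hle.and ((hasHilbertCoeffs_iff.1 h).1.and (eventually_gt_atTop 0)))).exists
  rw [hilbertSum_sub, ← hM n hn0, ← hn3] at hn1
  omega

open PowerSeries in
/-- The Hilbert coefficients of a function whose Hilbert series has the numerator
`∑ (-1)ⁱ cᵢ (1 - X)ⁱ` over `(1 - X)^(D + 1)`. -/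
lemma hasHilbertCoeffs_of_hilbertSeries {D m : ℕ} {H c : ℕ → ℤ}
    (h : hilbertSeries H * (1 - X) ^ (D + 1) =
      ∑ i ∈ Finset.range m, C (((-1) ^ i * c i : ℤ) : ℚ) * (1 - X) ^ i) (hm : D < m) :
    HasHilbertCoeffs D H (fun i => if i ≤ D then c i else 0) := by
  have hunit : (1 - X : ℚ⟦X⟧) ^ (D + 1) * (invOneSubPow ℚ (D + 1)).val = 1 := by
    rw [← invOneSubPow_inv_eq_one_sub_pow]
    exact (invOneSubPow ℚ (D + 1)).inv_val
  have hseries : hilbertSeries H = ∑ i ∈ Finset.range m,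
      C (((-1) ^ i * c i : ℤ) : ℚ) * ((1 - X) ^ i * (invOneSubPow ℚ (D + 1)).val) := by
    calc hilbertSeries H =
        hilbertSeries H * ((1 - X : ℚ⟦X⟧) ^ (D + 1) * (invOneSubPow ℚ (D + 1)).val) := by
          rw [hunit, mul_one]
      _ = _ := by
          rw [← mul_assoc, h, Finset.sum_mul]
          exact Finset.sum_congr rfl fun i _ => by rw [mul_assoc]
  have hlow : ∀ i ≤ D, ∀ n, coeff n ((1 - X : ℚ⟦X⟧) ^ i * (invOneSubPow ℚ (D + 1)).val) =
      ((n + (D - i)).choose (D - i) : ℚ) := by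
    intro i hi n
    rw [show D + 1 = (D - i + 1) + i by omega,
      one_sub_pow_mul_invOneSubPow_val_add_eq_invOneSubPow_val,
      invOneSubPow_val_succ_eq_mk_add_choose, coeff_mk, add_comm]
  -- Terms of index beyond D are polynomials of degree less than m after division, hence do not
  -- affect large n.
  have hhigh : ∀ i > D, ∀ n ≥ m, i < m →
      coeff n ((1 - X : ℚ⟦X⟧) ^ i * (invOneSubPow ℚ (D + 1)).val) = 0 := by
    intro i hi n hn him
    obtain ⟨j, rfl⟩ := Nat.exists_eq_add_of_le (show D + 1 ≤ i by omega)
    rw [pow_add, mul_right_comm, hunit, one_mul]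
    have : (1 - X : ℚ⟦X⟧) ^ j = (((1 - Polynomial.X) ^ j : Polynomial ℚ) : ℚ⟦X⟧) := by
      simp
    rw [this, Polynomial.coeff_coe]
    refine Polynomial.coeff_eq_zero_of_natDegree_lt ?_
    refine (Polynomial.natDegree_pow_le).trans_lt ?_
    have : (1 - Polynomial.X : Polynomial ℚ).natDegree ≤ 1 := by compute_degree
    nlinarith
  refine ⟨eventually_atTop.2 ⟨m, fun n hn => ?_⟩, fun i hi => if_neg (by omega)⟩
  have h1 : ((H n : ℤ) : ℚ) = coeff n (hilbertSeries H) := by rw [hilbertSeries, coeff_mk]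
  rw [hseries, map_sum, ← Finset.sum_subset (Finset.range_subset_range.2 (show D + 1 ≤ m by omega))]
    at h1
  · apply Int.cast_injective (α := ℚ)
    rw [h1, Int.cast_sum]
    refine Finset.sum_congr rfl fun i hi => ?_
    have hi' := Nat.lt_succ_iff.1 (Finset.mem_range.1 hi)
    beta_reduce
    rw [coeff_C_mul, hlow i hi', if_pos hi']
    push_cast; ring
  · intro i hi hi'
    rw [coeff_C_mul, hhigh i (by simpa using hi') n hn (Finset.mem_range.1 hi), mul_zero]

end HilbertCoefficients

/-! ### The filtration by I₁I₂ⁿ and its strictness. -/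

section Filtration

variable {R : Type*} [CommRing R]

/-- The filtration `R ⊇ I₁ ⊇ I₁I₂ ⊇ I₁I₂² ⊇ …`. -/
def fiberFiltration (I₁ I₂ : Ideal R) : ℕ → Ideal R
  | 0 => ⊤
  | n + 1 => I₁ * I₂ ^ n

@[simp] lemma fiberFiltration_zero (I₁ I₂ : Ideal R) : fiberFiltration I₁ I₂ 0 = ⊤ := rfl

lemma fiberFiltration_succ (I₁ I₂ : Ideal R) (n : ℕ) :
    fiberFiltration I₁ I₂ (n + 1) = I₁ * I₂ ^ n := rfl

lemma fiberFiltration_one (I₁ I₂ : Ideal R) : fiberFiltration I₁ I₂ 1 = I₁ := by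
  rw [fiberFiltration_succ, pow_zero, mul_one]

lemma mul_fiberFiltration_succ (I₁ I₂ : Ideal R) (n : ℕ) :
    I₂ * fiberFiltration I₁ I₂ (n + 1) = fiberFiltration I₁ I₂ (n + 2) := by
  rw [fiberFiltration_succ, fiberFiltration_succ, mul_left_comm, pow_succ']

lemma mul_fiberFiltration_le {I₁ I₂ : Ideal R} (h : I₂ ≤ I₁) (n : ℕ) :
    I₂ * fiberFiltration I₁ I₂ n ≤ fiberFiltration I₁ I₂ (n + 1) := by
  rcases n with _ | n
  · rw [fiberFiltration_one]
    exact Ideal.mul_le_left.trans h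
  · exact (mul_fiberFiltration_succ I₁ I₂ n).le

/-- Modulo Q only the remaining generators of J matter, so products with J and with those generators
agree. -/
lemma mul_mono_sup_eq {A B Q : Ideal R} {K : Ideal R} (hA : A = Q ⊔ K) :
    K * (B ⊔ Q) ⊔ Q = A * B ⊔ Q := by
  subst hA
  apply le_antisymm
  · rw [Ideal.mul_sup]
    refine sup_le (sup_le ?_ ?_) le_sup_right
    · exact (Ideal.mul_mono_left le_sup_right).trans le_sup_left
    · exact Ideal.mul_le_right.trans le_sup_right
  · rw [Ideal.sup_mul]
    refine sup_le (sup_le ?_ ?_) le_sup_right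
    · exact Ideal.mul_le_left.trans le_sup_right
    · exact (Ideal.mul_mono_right le_sup_left).trans le_sup_left

lemma IsSuperficial.mem_of_mul_mem {Q I₁ I₂ : Ideal R} {x : R} (hx : IsRegularMod Q x)
    (h : IsSuperficial (Ideal.Quotient.mk Q x) (I₂.map (Ideal.Quotient.mk Q))
      (I₁.map (Ideal.Quotient.mk Q))) :
    ∃ N, ∀ r ≥ N, ∀ k c, x * c ∈ I₁ ^ k * I₂ ^ (r + 1) ⊔ Q → c ∈ I₁ ^ k * I₂ ^ r ⊔ Q := by
  obtain ⟨-, r₀, -, h⟩ := h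
  refine ⟨r₀, fun r hr k c hc => ?_⟩
  have h1 := h (r + 1) (by omega) k
  rw [Nat.add_sub_cancel, ← Ideal.map_pow, ← Ideal.map_pow, ← Ideal.map_pow, ← Ideal.map_mul,
    ← Ideal.map_mul] at h1
  have h2 : Ideal.Quotient.mk Q (x * c) ∈ Ideal.span {Ideal.Quotient.mk Q x} ⊓
      (I₁ ^ k * I₂ ^ (r + 1)).map (Ideal.Quotient.mk Q) := by
    refine ⟨?_, Ideal.mem_quotient_iff_mem_sup.2 hc⟩
    rw [map_mul]
    exact Ideal.mul_mem_right _ _ (Ideal.mem_span_singleton_self _)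
  rw [h1] at h2
  obtain ⟨u, hu, huv⟩ := Ideal.mem_span_singleton_mul.1 h2
  obtain ⟨f, hf, rfl⟩ := (Ideal.mem_map_iff_of_surjective _ Ideal.Quotient.mk_surjective).1 hu
  rw [← map_mul, Ideal.Quotient.eq] at huv
  have h3 : c - f ∈ Q := by
    apply hx
    have : x * (c - f) = -(x * f - x * c) := by ring
    rw [this]
    exact Q.neg_mem huv
  have : c = f + (c - f) := by ring
  rw [this]
  exact Submodule.add_mem_sup hf h3

variable [IsLocalRing R]

/-- A superficial regular sequence `x` of length `d` for `I₂` and `I₁ ⊇ I₂` generating a reduction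
`J` of `I₂`, such that `I₁I₂ / I₁J` has length at most one and is generated by `ab`. -/
structure IsAlmostMinimal (x : ℕ → R) (d : ℕ) (I₁ I₂ : Ideal R) (a b : R) : Prop where
  regular : ∀ i < d, IsRegularMod (partialIdeal x i) (x i)
  le_right : partialIdeal x d ≤ I₂
  le_left : I₂ ≤ I₁
  superficial : ∃ N, ∀ i < d, ∀ r ≥ N, ∀ k c,
    x i * c ∈ I₁ ^ k * I₂ ^ (r + 1) ⊔ partialIdeal x i → c ∈ I₁ ^ k * I₂ ^ r ⊔ partialIdeal x i
  reduction : ∃ N, I₂ ^ (N + 1) ≤ partialIdeal x d * I₂ ^ N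
  pow_le : ∃ k, maximalIdeal R ^ k ≤ partialIdeal x d
  mem_left : a ∈ I₁
  mem_right : b ∈ I₂
  le_sup : I₁ * I₂ ≤ I₁ * partialIdeal x d ⊔ Ideal.span {a * b}
  mul_mem : ∀ z ∈ maximalIdeal R, z * (a * b) ∈ I₁ * partialIdeal x d

namespace IsAlmostMinimal

variable {x : ℕ → R} {d : ℕ} {I₁ I₂ : Ideal R} {a b : R}

local notation "𝓕" => fiberFiltration I₁ I₂

lemma exists_pow_le_mul {A B : Ideal R} (hA : ∃ k, maximalIdeal R ^ k ≤ A)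
    (hB : ∃ k, maximalIdeal R ^ k ≤ B) : ∃ k, maximalIdeal R ^ k ≤ A * B := by
  obtain ⟨k, hk⟩ := hA
  obtain ⟨l, hl⟩ := hB
  exact ⟨k + l, by rw [pow_add]; exact Ideal.mul_mono hk hl⟩

lemma exists_pow_le_pow {A : Ideal R} (hA : ∃ k, maximalIdeal R ^ k ≤ A) (n : ℕ) :
    ∃ k, maximalIdeal R ^ k ≤ A ^ n := by
  obtain ⟨k, hk⟩ := hA
  exact ⟨k * n, by rw [pow_mul]; exact Ideal.pow_right_mono hk n⟩

lemma exists_pow_le_filtration (h : IsAlmostMinimal x d I₁ I₂ a b) (n : ℕ) :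
    ∃ k, maximalIdeal R ^ k ≤ 𝓕 n := by
  have h2 : ∃ k, maximalIdeal R ^ k ≤ I₂ := h.pow_le.imp fun _ hk => hk.trans h.le_right
  rcases n with _ | n
  · exact ⟨0, le_top⟩
  · exact exists_pow_le_mul (h2.imp fun _ hk => hk.trans h.le_left) (exists_pow_le_pow h2 n)

lemma finiteColength_mul [IsNoetherianRing R] (h : IsAlmostMinimal x d I₁ I₂ a b) (n : ℕ) :
    FiniteColength (partialIdeal x d * 𝓕 n) := by
  obtain ⟨k, hk⟩ := exists_pow_le_mul h.pow_le (h.exists_pow_le_filtration n)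
  exact finiteColength_of_pow_le hk

lemma finiteColength [IsNoetherianRing R] (h : IsAlmostMinimal x d I₁ I₂ a b) (n : ℕ) :
    FiniteColength (𝓕 n) :=
  (h.finiteColength_mul n).mono Ideal.mul_le_right

lemma mul_le (h : IsAlmostMinimal x d I₁ I₂ a b) (n : ℕ) :
    partialIdeal x d * 𝓕 n ≤ 𝓕 (n + 1) :=
  (Ideal.mul_mono_left h.le_right).trans (mul_fiberFiltration_le h.le_left n)

lemma filtration_le (h : IsAlmostMinimal x d I₁ I₂ a b) (n : ℕ) :
    𝓕 (n + 2) ≤ partialIdeal x d * 𝓕 (n + 1) ⊔ Ideal.span {a * b ^ (n + 1)} := by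
  induction n with
  | zero =>
    have := h.le_sup
    rw [mul_comm I₁ (partialIdeal x d)] at this
    rwa [zero_add, zero_add, fiberFiltration_one, pow_one, fiberFiltration_succ I₁ I₂ 1, pow_one]
  | succ n ih =>
    rw [← mul_fiberFiltration_succ]
    refine (Ideal.mul_mono_right ih).trans ?_
    rw [Ideal.mul_sup, mul_left_comm, mul_fiberFiltration_succ]
    refine sup_le le_sup_left (Ideal.mul_le.2 fun z hz w hw => ?_)
    obtain ⟨r, rfl⟩ := Ideal.mem_span_singleton'.1 hw
    -- Since az ∈ I₁I₂, it equals u + tab with u ∈ I₁J. Multiplying by bⁿ⁺¹ trades zabⁿ⁺¹ for a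
    -- multiple of abⁿ⁺² modulo J `𝓕 (n + 2)`.
    obtain ⟨u, hu, v, hv, huv⟩ := Submodule.mem_sup.1 (h.le_sup (Ideal.mul_mem_mul h.mem_left hz))
    obtain ⟨t, rfl⟩ := Ideal.mem_span_singleton'.1 hv
    have h1 : z * (r * (a * b ^ (n + 1))) = r * (u * b ^ (n + 1)) + r * t * (a * b ^ (n + 1 + 1)) := by
      linear_combination (-(r * b ^ (n + 1))) * huv
    rw [h1]
    refine Submodule.add_mem_sup (Ideal.mul_mem_left _ _ ?_)
      (Ideal.mul_mem_left _ _ (Ideal.mem_span_singleton_self _))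
    have h2 := Ideal.mul_mem_mul hu (Ideal.pow_mem_pow h.mem_right (n + 1))
    rwa [mul_right_comm, mul_comm _ (partialIdeal x d)] at h2

lemma mul_mem_mul_filtration (h : IsAlmostMinimal x d I₁ I₂ a b) (n : ℕ) {z : R}
    (hz : z ∈ maximalIdeal R) : z * (a * b ^ (n + 1)) ∈ partialIdeal x d * 𝓕 (n + 1) := by
  have h2 := Ideal.mul_mem_mul (h.mul_mem z hz) (Ideal.pow_mem_pow h.mem_right n)
  rw [mul_right_comm, mul_comm _ (partialIdeal x d)] at h2
  have : z * (a * b ^ (n + 1)) = z * (a * b) * b ^ n := by ring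
  rwa [this]

lemma colength_le_add_one [IsNoetherianRing R] (h : IsAlmostMinimal x d I₁ I₂ a b) (n : ℕ)
    (Q : Ideal R) :
    colength (partialIdeal x d * 𝓕 (n + 1) ⊔ Q) ≤ colength (𝓕 (n + 2) ⊔ Q) + 1 := by
  set A := partialIdeal x d * 𝓕 (n + 1) ⊔ Q with hA
  have hfin : FiniteColength A := (h.finiteColength_mul _).mono le_sup_left
  rw [colength_eq_colon_add (C := colonElem A (a * b ^ (n + 1))) hfin fun _ => mem_colonElem]
  have h1 : colength (colonElem A (a * b ^ (n + 1))) ≤ 1 := by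
    rw [← colength_maximalIdeal (R := R)]
    refine colength_anti finiteColength_maximalIdeal fun z hz => ?_
    rw [mem_colonElem, mul_comm]
    exact Ideal.mem_sup_left (h.mul_mem_mul_filtration n hz)
  have h2 : colength (A ⊔ Ideal.span {a * b ^ (n + 1)}) ≤ colength (𝓕 (n + 2) ⊔ Q) := by
    refine colength_anti ((h.finiteColength _).mono le_sup_left) (sup_le ?_ ?_)
    · exact (h.filtration_le n).trans (sup_le_sup_right le_sup_left _)
    · exact le_sup_right.trans le_sup_left
  omega

lemma exists_filtration_superficial (h : IsAlmostMinimal x d I₁ I₂ a b) :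
    ∃ N, ∀ i < d, ∀ n ≥ N, ∀ c, x i * c ∈ 𝓕 (n + 1) ⊔ partialIdeal x i →
      c ∈ 𝓕 n ⊔ partialIdeal x i := by
  obtain ⟨N, hN⟩ := h.superficial
  refine ⟨N + 1, fun i hi n hn c hc => ?_⟩
  obtain ⟨m, rfl⟩ : ∃ m, n = m + 1 := ⟨n - 1, by omega⟩
  have := hN i hi m (by omega) 1 c
  rw [pow_one] at this
  exact this hc

lemma exists_filtration_reduction (h : IsAlmostMinimal x d I₁ I₂ a b) :
    ∃ N, ∀ n ≥ N, 𝓕 (n + 1) ≤ partialIdeal x d * 𝓕 n := by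
  obtain ⟨N, hN⟩ := h.reduction
  refine ⟨N + 1, fun n hn => ?_⟩
  obtain ⟨j, rfl⟩ := Nat.exists_eq_add_of_le hn
  have h1 : I₂ ^ (N + 1 + j) ≤ partialIdeal x d * I₂ ^ (N + j) := by
    rw [pow_add I₂ (N + 1) j, pow_add I₂ N j, ← mul_assoc]
    exact Ideal.mul_mono_left hN
  rw [fiberFiltration_succ, show N + 1 + j = (N + j) + 1 by omega, fiberFiltration_succ,
    mul_left_comm]
  rw [show N + j + 1 = N + 1 + j by omega]
  exact Ideal.mul_mono_right h1

lemma partialIdeal_le (h : IsAlmostMinimal x d I₁ I₂ a b) {i : ℕ} (hi : i ≤ d) :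
    partialIdeal x i ≤ I₂ := (partialIdeal_mono x hi).trans h.le_right

/-- The filtration is strict along `xᵢ` modulo `x₀, …, xᵢ₋₁`, for `i ≤ d - 2`. -/
lemma strict [IsNoetherianRing R] (h : IsAlmostMinimal x d I₁ I₂ a b) :
    ∀ i, i + 2 ≤ d → ∀ n c, x i * c ∈ 𝓕 (n + 1) ⊔ partialIdeal x i →
      c ∈ 𝓕 n ⊔ partialIdeal x i := by
  obtain ⟨N₁, hN₁⟩ := h.exists_filtration_superficial
  obtain ⟨N₂, hN₂⟩ := h.exists_filtration_reduction
  -- Descending induction on i: i = d - 2 is the two-dimensional theorem, and strictness of `x (i +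
  -- 1)` modulo `x i` gives strictness of `x i` by Sally's machine.
  suffices hk : ∀ k i, i + 2 + k = d → ∀ n c, x i * c ∈ 𝓕 (n + 1) ⊔ partialIdeal x i →
      c ∈ 𝓕 n ⊔ partialIdeal x i from fun i hi => hk (d - (i + 2)) i (by omega)
  have hmul : ∀ i, ∀ n, I₂ * (𝓕 n ⊔ partialIdeal x i) ≤ 𝓕 (n + 1) ⊔ partialIdeal x i := by
    intro i n
    rw [Ideal.mul_sup]
    exact sup_le_sup (mul_fiberFiltration_le h.le_left n) Ideal.mul_le_right
  have hxI : ∀ i < d, x i ∈ I₂ := fun i hi => h.le_right (mem_partialIdeal x hi)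
  intro k
  induction k with
  | zero =>
    intro i hi
    have hsucc : partialIdeal x i ⊔ Ideal.span {x i} = partialIdeal x (i + 1) :=
      (partialIdeal_succ x i).symm
    have hJ : partialIdeal x d = partialIdeal x i ⊔ Ideal.span {x i, x (i + 1)} := by
      rw [Ideal.span_insert, ← sup_assoc, hsucc, ← partialIdeal_succ, ← hi]
    have hKG : ∀ n, Ideal.span {x i, x (i + 1)} * (𝓕 n ⊔ partialIdeal x i) ⊔ partialIdeal x i =
        partialIdeal x d * 𝓕 n ⊔ partialIdeal x i := fun n => mul_mono_sup_eq hJ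
    refine mem_of_mul_mem_of_length_le_one (Q := partialIdeal x i) (I := I₂)
      (G := fun n => 𝓕 n ⊔ partialIdeal x i) (x := x i) (y := x (i + 1)) (a := a) (b := b)
      (N := max N₁ N₂) (by simp) (fun n => le_sup_right) (hmul i) (fun n => ?_)
      (hxI i (by omega)) (hxI (i + 1) (by omega)) (h.regular i (by omega)) ?_
      (fun n hn => hN₁ i (by omega) n (le_of_max_le_left hn)) (fun n hn => ?_) (fun n => ?_)
      (fun n => ?_) ?_ h.mem_right (fun n => ?_)
    · rw [← mul_fiberFiltration_succ]
      exact sup_le_sup_right (Ideal.mul_mono_right le_sup_left) _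
    · rw [hsucc]
      exact h.regular (i + 1) (by omega)
    · rw [hKG]
      exact sup_le_sup_right (hN₂ n (le_of_max_le_right hn)) _
    · rw [hKG]
      exact (h.finiteColength_mul n).mono le_sup_left
    · rw [hKG]
      exact h.colength_le_add_one n _
    · rw [fiberFiltration_one]
      exact Ideal.mem_sup_left h.mem_left
    · rw [hKG]
      exact sup_le ((h.filtration_le n).trans (sup_le_sup_right le_sup_left _))
        (le_sup_right.trans le_sup_left)
  | succ k ih =>
    intro i hi
    have hsucc : ∀ n, 𝓕 n ⊔ partialIdeal x i ⊔ Ideal.span {x i} = 𝓕 n ⊔ partialIdeal x (i + 1) :=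
      fun n => by rw [sup_assoc, ← partialIdeal_succ]
    refine mem_of_mul_mem_of_mod (G := fun n => 𝓕 n ⊔ partialIdeal x i) (x := x i)
      (y := x (i + 1)) (N := N₁) (by simp)
      (fun n c hc => hmul i n (Ideal.mul_mem_mul (hxI i (by omega)) hc))
      (fun n c hc => hmul i n (Ideal.mul_mem_mul (hxI (i + 1) (by omega)) hc))
      (fun n hn => hN₁ i (by omega) n hn) (fun n c hc => ?_)
    beta_reduce at hc ⊢
    rw [hsucc] at hc ⊢
    exact ih (i + 1) (by omega) n c hc

/-- The terms are removed one at a time: by strictness the multiple of `x i` that occurs lies in `x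
i` `𝓕 n` ⊆ J `𝓕 n`, up to earlier terms. Thus s can be detected modulo d - 1 terms. -/
lemma filtration_le_mul_of_le_sup [IsNoetherianRing R] (h : IsAlmostMinimal x d I₁ I₂ a b)
    {i n : ℕ} (hi : i + 1 ≤ d) (hle : 𝓕 (n + 1) ≤ partialIdeal x d * 𝓕 n ⊔ partialIdeal x i) :
    𝓕 (n + 1) ≤ partialIdeal x d * 𝓕 n := by
  induction i with
  | zero => simpa using hle
  | succ i ih =>
    refine ih (by omega) fun f hf => ?_
    have h1 := hle hf
    rw [partialIdeal_succ, ← sup_assoc] at h1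
    obtain ⟨u, hu, v, hv, rfl⟩ := Submodule.mem_sup.1 h1
    obtain ⟨c, rfl⟩ := Ideal.mem_span_singleton.1 hv
    have hc : x i * c ∈ 𝓕 (n + 1) ⊔ partialIdeal x i := by
      have : x i * c = (u + x i * c) - u := by ring
      rw [this]
      exact Ideal.sub_mem _ (Ideal.mem_sup_left hf) (sup_le_sup_right (h.mul_le n) _ hu)
    obtain ⟨f', hf', q, hq, rfl⟩ := Submodule.mem_sup.1 (h.strict i (by omega) n c hc)
    refine Ideal.add_mem _ hu ?_
    rw [mul_add]
    exact Submodule.add_mem_sup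
      (Ideal.mul_mem_mul (mem_partialIdeal x (by omega)) hf') (Ideal.mul_mem_left _ _ hq)

lemma colength_succ [IsNoetherianRing R] (h : IsAlmostMinimal x d I₁ I₂ a b) {i : ℕ}
    (hi : i + 2 ≤ d) (n : ℕ) :
    colength (𝓕 (n + 1) ⊔ partialIdeal x i) =
      colength (𝓕 n ⊔ partialIdeal x i) + colength (𝓕 (n + 1) ⊔ partialIdeal x (i + 1)) := by
  rw [partialIdeal_succ, ← sup_assoc]
  refine colength_eq_colon_add ((h.finiteColength _).mono le_sup_left) fun c =>
    ⟨fun hc => ?_, h.strict i hi n c⟩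
  have hxI : x i ∈ I₂ := h.le_right (mem_partialIdeal x (by omega))
  obtain ⟨f, hf, q, hq, rfl⟩ := Submodule.mem_sup.1 hc
  rw [mul_add]
  exact Submodule.add_mem_sup (mul_fiberFiltration_le h.le_left n (Ideal.mul_mem_mul hxI hf))
    (Ideal.mul_mem_left _ _ hq)

lemma colength_mul_sup [IsNoetherianRing R] {i : ℕ} (h : IsAlmostMinimal x (i + 1) I₁ I₂ a b)
    (n : ℕ) :
    colength (partialIdeal x (i + 1) * 𝓕 n ⊔ partialIdeal x i) =
      colength (𝓕 n ⊔ partialIdeal x i) + colength (partialIdeal x (i + 1)) := by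
  have hfin : FiniteColength (partialIdeal x (i + 1) * 𝓕 n ⊔ partialIdeal x i) :=
    (h.finiteColength_mul n).mono le_sup_left
  rw [colength_eq_colon_add (C := 𝓕 n ⊔ partialIdeal x i) (x := x i) hfin, sup_assoc,
    ← partialIdeal_succ,
    sup_eq_right.2 (Ideal.mul_le_left : partialIdeal x (i + 1) * 𝓕 n ≤ partialIdeal x (i + 1))]
  intro c
  constructor
  · intro hc
    obtain ⟨f, hf, q, hq, rfl⟩ := Submodule.mem_sup.1 hc
    rw [mul_add]
    exact Submodule.add_mem_sup
      (Ideal.mul_mem_mul (mem_partialIdeal x (Nat.lt_succ_self i)) hf) (Ideal.mul_mem_left _ _ hq)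
  · intro hc
    rw [← mul_mono_sup_eq (partialIdeal_succ x i)] at hc
    obtain ⟨u, hu, q, hq, huq⟩ := Submodule.mem_sup.1 hc
    obtain ⟨f, hf, rfl⟩ := Ideal.mem_span_singleton_mul.1 hu
    have h1 : c - f ∈ partialIdeal x i := by
      apply h.regular i (Nat.lt_succ_self i)
      have : x i * (c - f) = q := by linear_combination -huq
      rwa [this]
    have : c = f + (c - f) := by ring
    rw [this]
    exact Ideal.add_mem _ hf (Ideal.mem_sup_right h1)

end IsAlmostMinimal

end Filtration

/-! ### Hilbert functions of powers, and the generator ab. -/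

section Powers

variable {R : Type*} [CommRing R]

/-- The colon of Jⁿ⁺¹ by a generator contains Jⁿ, which bounds each difference without regularity;
summation is Pascal's rule. -/
lemma colength_pow_sup_le {x : ℕ → R} {d : ℕ}
    (hfin : ∀ n, FiniteColength (partialIdeal x d ^ n)) :
    ∀ m ≤ d, ∀ n, colength (partialIdeal x d ^ (n + 1) ⊔ partialIdeal x (d - m)) ≤
      colength (partialIdeal x d) * ((n + m).choose m : ℤ) := by
  intro m
  induction m with
  | zero =>
    intro _ n
    rw [Nat.sub_zero, sup_eq_right.2 (Ideal.pow_le_self (Nat.succ_ne_zero n))]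
    simp
  | succ m ih =>
    intro hm
    have step : ∀ n, colength (partialIdeal x d ^ (n + 1) ⊔ partialIdeal x (d - (m + 1))) ≤
        colength (partialIdeal x d ^ n ⊔ partialIdeal x (d - (m + 1))) +
          colength (partialIdeal x d) * ((n + m).choose m : ℤ) := by
      intro n
      set i := d - (m + 1) with hi
      have hi' : d - m = i + 1 := by omega
      rw [colength_eq_colon_add (C := colonElem (partialIdeal x d ^ (n + 1) ⊔ partialIdeal x i) (x i))
        ((hfin _).mono le_sup_left) fun _ => mem_colonElem]
      refine add_le_add (colength_anti ((hfin n).mono le_sup_left) fun c hc => ?_) ?_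
      · obtain ⟨f, hf, q, hq, rfl⟩ := Submodule.mem_sup.1 hc
        rw [mem_colonElem, mul_add, pow_succ']
        exact Submodule.add_mem_sup (Ideal.mul_mem_mul (mem_partialIdeal x (by omega)) hf)
          (Ideal.mul_mem_left _ _ hq)
      · rw [sup_assoc, ← partialIdeal_succ, ← hi']
        exact ih (by omega) n
    intro n
    induction n with
    | zero =>
      have := step 0
      simpa using this
    | succ n ihn =>
      refine (step (n + 1)).trans ((add_le_add_left ihn _).trans (le_of_eq ?_))
      rw [show n + 1 + (m + 1) = (n + (m + 1)) + 1 by omega, Nat.choose_succ_succ,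
        show n + 1 + m = n + (m + 1) by omega]
      push_cast; ring

/-- The Hilbert function of a superficial regular sequence of length `d` that generates a
reduction of `I` is of polynomial type of degree `d` with leading coefficient `ℓ(R/J)`. -/
lemma exists_hasHilbertCoeffs {x : ℕ → R} {d N N' : ℕ} {I : Ideal R}
    (hfin : ∀ n, FiniteColength (I ^ n)) (hJ : partialIdeal x d ≤ I)
    (hsup : ∀ i < d, ∀ n ≥ N, ∀ c,
      x i * c ∈ I ^ (n + 1) ⊔ partialIdeal x i → c ∈ I ^ n ⊔ partialIdeal x i)
    (hred : I ^ (N' + 1) ≤ partialIdeal x d) :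
    ∃ c, HasHilbertCoeffs d (fun n => colength (I ^ n)) c ∧ c 0 = colength (partialIdeal x d) := by
  suffices h : ∀ m ≤ d, ∃ c, HasHilbertCoeffs m
      (fun n => colength (I ^ n ⊔ partialIdeal x (d - m))) c ∧ c 0 = colength (partialIdeal x d) by
    simpa using h d le_rfl
  intro m
  induction m with
  | zero =>
    intro _
    -- Modulo all of J, large powers of I vanish and the function is the constant ℓ(R/J); this
    -- becomes the leading coefficient.
    refine ⟨fun i => if i = 0 then colength (partialIdeal x d) else 0,
      ⟨eventually_atTop.2 ⟨N' + 1, fun n hn => ?_⟩, fun i hi => if_neg (by omega)⟩, if_pos rfl⟩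
    beta_reduce
    rw [Nat.sub_zero, sup_eq_right.2 ((Ideal.pow_le_pow_right hn).trans hred)]
    simp
  | succ m ih =>
    intro hm
    obtain ⟨c, hc, hc0⟩ := ih (by omega)
    obtain ⟨c', hc', hc0'⟩ := hc.exists_of_succ
      (H := fun n => colength (I ^ n ⊔ partialIdeal x (d - (m + 1)))) (by
        refine eventually_atTop.2 ⟨N, fun n hn => ?_⟩
        set i := d - (m + 1) with hi
        have hi' : d - m = i + 1 := by omega
        rw [hi', partialIdeal_succ, ← sup_assoc]
        refine colength_eq_colon_add ((hfin _).mono le_sup_left) fun c =>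
          ⟨fun hc => ?_, hsup i (by omega) n hn c⟩
        obtain ⟨f, hf, q, hq, rfl⟩ := Submodule.mem_sup.1 hc
        rw [mul_add, pow_succ']
        exact Submodule.add_mem_sup
          (Ideal.mul_mem_mul (hJ (mem_partialIdeal x (by omega))) hf) (Ideal.mul_mem_left _ _ hq))
    exact ⟨c', hc', hc0'.trans hc0⟩

/-- If A ≠ I₁I₂, some product ab lies outside A. As the length is at most one, ab generates the
quotient and A : ab has colength one, hence is the maximal ideal. -/
lemma exists_mul_generator [IsLocalRing R] {I₁ I₂ A : Ideal R} (hA : A ≤ I₁ * I₂)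
    (hfin : FiniteColength A) (hle : colength A ≤ colength (I₁ * I₂) + 1) :
    ∃ a ∈ I₁, ∃ b ∈ I₂, I₁ * I₂ ≤ A ⊔ Ideal.span {a * b} ∧
      ∀ z ∈ maximalIdeal R, z * (a * b) ∈ A := by
  by_cases h : I₁ * I₂ ≤ A
  · exact ⟨0, I₁.zero_mem, 0, I₂.zero_mem, h.trans le_sup_left, by simp⟩
  rw [Ideal.mul_le] at h
  push Not at h
  obtain ⟨a, ha, b, hb, hab⟩ := h
  have h1 := colength_sup_span_lt hfin hab
  have h2 : A ⊔ Ideal.span {a * b} ≤ I₁ * I₂ :=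
    sup_le hA ((Ideal.span_singleton_le_iff_mem _).2 (Ideal.mul_mem_mul ha hb))
  have h3 := eq_of_colength_le (hfin.mono le_sup_left) h2 (by omega)
  refine ⟨a, ha, b, hb, h3.ge, fun z hz => ?_⟩
  have h4 := colength_eq_colon_add (C := colonElem A (a * b)) hfin fun _ => mem_colonElem
  rw [h3] at h4
  have hfin' : FiniteColength (colonElem A (a * b)) :=
    hfin.mono fun c hc => mem_colonElem.2 (Ideal.mul_mem_left _ _ hc)
  have h5 : colonElem A (a * b) ≤ maximalIdeal R := by
    refine IsLocalRing.le_maximalIdeal fun ht => hab ?_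
    have : (1 : R) ∈ colonElem A (a * b) := ht ▸ Submodule.mem_top
    simpa using this
  have h6 := eq_of_colength_le hfin' h5 (by rw [colength_maximalIdeal]; omega)
  rw [← h6, mem_colonElem] at hz
  rwa [mul_comm]

end Powers

/-! ### The Hilbert series of the filtration. -/

namespace IsAlmostMinimal

variable {R : Type*} [CommRing R] [IsLocalRing R] [IsNoetherianRing R]
  {x : ℕ → R} {d : ℕ} {I₁ I₂ : Ideal R} {a b : R}

local notation "𝓕" => fiberFiltration I₁ I₂

omit [IsNoetherianRing R] in
-- The defining equality persists under multiplication by I₂ and holds for large n because J is a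
-- reduction; so the infimum is attained and is not the default value of an empty set.
lemma le_sNumber_iff (h : IsAlmostMinimal x d I₁ I₂ a b) (n : ℕ) :
    sNumber (partialIdeal x d) I₁ I₂ ≤ n ↔ 𝓕 (n + 2) ≤ partialIdeal x d * 𝓕 (n + 1) := by
  have hset : ∀ n, n ∈ {n : ℕ | partialIdeal x d * I₁ * I₂ ^ n = I₁ * I₂ ^ (n + 1)} ↔
      𝓕 (n + 2) ≤ partialIdeal x d * 𝓕 (n + 1) := by
    intro n
    change partialIdeal x d * I₁ * I₂ ^ n = I₁ * I₂ ^ (n + 1) ↔ _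
    rw [mul_assoc]
    exact ⟨fun hn => hn.ge, fun hn => le_antisymm (h.mul_le (n + 1)) hn⟩
  have hsucc : ∀ n, 𝓕 (n + 2) ≤ partialIdeal x d * 𝓕 (n + 1) →
      𝓕 (n + 1 + 2) ≤ partialIdeal x d * 𝓕 (n + 1 + 1) := by
    intro n hn
    calc 𝓕 (n + 1 + 2) = I₂ * 𝓕 (n + 2) := (mul_fiberFiltration_succ I₁ I₂ (n + 1)).symm
      _ ≤ I₂ * (partialIdeal x d * 𝓕 (n + 1)) := Ideal.mul_mono_right hn
      _ = partialIdeal x d * (I₂ * 𝓕 (n + 1)) := mul_left_comm _ _ _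
      _ = partialIdeal x d * 𝓕 (n + 1 + 1) := by rw [mul_fiberFiltration_succ I₁ I₂ n]
  constructor
  · intro hn
    have hne : {n : ℕ | partialIdeal x d * I₁ * I₂ ^ n = I₁ * I₂ ^ (n + 1)}.Nonempty := by
      obtain ⟨N, hN⟩ := h.exists_filtration_reduction
      exact ⟨N, (hset N).2 (hN (N + 1) (by omega))⟩
    have h1 := (hset _).1 (Nat.sInf_mem hne)
    change sInf _ ≤ n at hn
    obtain ⟨j, rfl⟩ := Nat.exists_eq_add_of_le hn
    clear hn
    induction j with
    | zero => exact h1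
    | succ j ih => exact hsucc _ ih
  · exact fun hn => Nat.sInf_le ((hset n).2 hn)

/-- In dimension one, passing from `𝓕 (n + 1)` to J `𝓕 (n + 1)` adds ℓ(R/J); what remains up to `𝓕
(n + 2)` has length one for n < s and zero afterwards. -/
lemma colength_succ_eq {i : ℕ} (h : IsAlmostMinimal x (i + 1) I₁ I₂ a b) (n : ℕ) :
    colength (𝓕 (n + 2) ⊔ partialIdeal x i) = colength (𝓕 (n + 1) ⊔ partialIdeal x i) +
      colength (partialIdeal x (i + 1)) -
        if n < sNumber (partialIdeal x (i + 1)) I₁ I₂ then 1 else 0 := by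
  have h1 := h.colength_mul_sup (n + 1)
  have h2 := h.colength_le_add_one n (partialIdeal x i)
  have hfin : FiniteColength (partialIdeal x (i + 1) * 𝓕 (n + 1) ⊔ partialIdeal x i) :=
    (h.finiteColength_mul _).mono le_sup_left
  have hle : partialIdeal x (i + 1) * 𝓕 (n + 1) ⊔ partialIdeal x i ≤
      𝓕 (n + 2) ⊔ partialIdeal x i := sup_le_sup_right (h.mul_le _) _
  have h3 := colength_anti hfin hle
  have h4 := h.le_sNumber_iff n
  split_ifs with hn
  · have hne : colength (partialIdeal x (i + 1) * 𝓕 (n + 1) ⊔ partialIdeal x i) ≠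
        colength (𝓕 (n + 2) ⊔ partialIdeal x i) := by
      intro heq
      refine absurd (h4.2 (h.filtration_le_mul_of_le_sup (i := i) le_rfl ?_)) (not_le.2 hn)
      exact le_sup_left.trans (eq_of_colength_le hfin hle heq.le).ge
    omega
  · have heq : partialIdeal x (i + 1) * 𝓕 (n + 1) ⊔ partialIdeal x i =
        𝓕 (n + 2) ⊔ partialIdeal x i :=
      le_antisymm hle (sup_le_sup_right (h4.1 (not_lt.1 hn)) _)
    rw [← heq]
    omega

open PowerSeries in
/-- The Hilbert series of the filtration modulo the first `d - 1 - m` terms of `x`. -/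
lemma hilbertSeries_mul_pow {e : ℕ} (h : IsAlmostMinimal x (e + 1) I₁ I₂ a b) :
    ∀ m ≤ e, hilbertSeries (fun n => colength (𝓕 (n + 1) ⊔ partialIdeal x (e - m))) *
      (1 - X) ^ (m + 2) =
        C (colength I₁ : ℚ) - X * C (colength I₁ - colength (partialIdeal x (e + 1)) + 1 : ℚ) +
          X ^ (sNumber (partialIdeal x (e + 1)) I₁ I₂ + 1) := by
  have hone : ∀ i ≤ e + 1, 𝓕 1 ⊔ partialIdeal x i = I₁ := by
    intro i hi
    rw [fiberFiltration_one]
    exact sup_eq_left.2 ((h.partialIdeal_le hi).trans h.le_left)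
  have hsub0 : ∀ f : ℚ⟦X⟧, coeff 0 (f * (1 - X)) = coeff 0 f := by
    intro f
    rw [mul_sub, mul_one, map_sub, coeff_zero_mul_X, sub_zero]
  have hsub : ∀ (f : ℚ⟦X⟧) (n : ℕ), coeff (n + 1) (f * (1 - X)) =
      coeff (n + 1) f - coeff n f := by
    intro f n
    rw [mul_sub, mul_one, map_sub, coeff_succ_mul_X]
  intro m
  induction m with
  | zero =>
    intro _
    set s := sNumber (partialIdeal x (e + 1)) I₁ I₂ with hs
    have hH : ∀ n, coeff n (hilbertSeries (fun n => colength (𝓕 (n + 1) ⊔ partialIdeal x (e - 0))))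
        = (colength (𝓕 (n + 1) ⊔ partialIdeal x e) : ℚ) := fun n => by
      rw [hilbertSeries, coeff_mk, Nat.sub_zero]
    have hrec : ∀ n, (colength (𝓕 (n + 2) ⊔ partialIdeal x e) : ℚ) =
        colength (𝓕 (n + 1) ⊔ partialIdeal x e) + colength (partialIdeal x (e + 1)) -
          if n < s then 1 else 0 := by
      intro n
      rw [h.colength_succ_eq n]
      push_cast
      rfl
    -- Multiplication by (1 - X)² takes second differences. In degree n + 2 these are [n < s] - [n +
    -- 1 < s], which is the coefficient of Xˢ⁺¹; degrees 0 and 1 give the remaining terms.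
    rw [zero_add, pow_two, ← mul_assoc]
    ext n
    match n with
    | 0 =>
      rw [hsub0, hsub0, hH, zero_add, hone e (by omega)]
      simp
    | 1 =>
      rw [hsub, hsub, hsub0, hH, hH, hrec 0, zero_add, hone e (by omega)]
      have h1 : coeff 1 (X ^ (s + 1) : ℚ⟦X⟧) = if 0 < s then 0 else 1 := by
        rw [coeff_X_pow]
        split_ifs <;> first | rfl | omega
      have h2 : coeff 1 (C (colength I₁ : ℚ)) = 0 := by rw [coeff_C, if_neg one_ne_zero]
      rw [map_add, map_sub, h1, h2, show (1 : ℕ) = 0 + 1 from rfl, coeff_succ_X_mul, coeff_zero_C]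
      split_ifs <;> ring
    | n + 2 =>
      rw [hsub, hsub, hsub, hH, hH, hH, hrec (n + 1), hrec n]
      have h1 : coeff (n + 2) (X ^ (s + 1) : ℚ⟦X⟧) =
          (if n < s then 1 else 0) - if n + 1 < s then 1 else 0 := by
        rw [coeff_X_pow]
        split_ifs <;> first | omega | norm_num
      have h2 : coeff (n + 2) (C (colength I₁ : ℚ)) = 0 := by
        rw [coeff_C, if_neg (Nat.succ_ne_zero _)]
      rw [map_add, map_sub, h1, h2, show n + 2 = (n + 1) + 1 from rfl, coeff_succ_X_mul, coeff_C,
        if_neg (Nat.succ_ne_zero n)]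
      ring
  | succ m ih =>
    intro hm
    rw [← ih (by omega), pow_succ' _ (m + 2), ← mul_assoc]
    congr 1
    obtain ⟨i, hi⟩ : ∃ i, e - (m + 1) = i := ⟨_, rfl⟩
    rw [show e - m = i + 1 by omega, hi]
    ext n
    rcases n with _ | n
    · rw [hsub0]
      simp only [hilbertSeries, coeff_mk, zero_add]
      rw [hone i (by omega), hone (i + 1) (by omega)]
    · rw [hsub]
      simp only [hilbertSeries, coeff_mk]
      rw [h.colength_succ (i := i) (by omega) (n + 1)]
      push_cast
      ring

end IsAlmostMinimal

/-! ### From finite sequences to sequences indexed by ℕ. -/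

section FinSequences

variable {R : Type*} [CommRing R]

/-- The extension of a finite sequence by zero. -/
def extendZero {d : ℕ} (x : Fin d → R) (n : ℕ) : R := if h : n < d then x ⟨n, h⟩ else 0

@[simp] lemma extendZero_fin {d : ℕ} (x : Fin d → R) (i : Fin d) : extendZero x i = x i :=
  dif_pos i.2

lemma initialIdeal_eq_partialIdeal {d : ℕ} (x : Fin d → R) (i : Fin d) :
    initialIdeal x i = partialIdeal (extendZero x) i := by
  unfold initialIdeal partialIdeal
  congr 1
  ext c
  constructor
  · rintro ⟨j, hj, rfl⟩
    exact ⟨j, hj, extendZero_fin x j⟩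
  · rintro ⟨j, hj, rfl⟩
    have hj' : j < d := lt_trans hj i.2
    exact ⟨⟨j, hj'⟩, hj, (extendZero_fin x ⟨j, hj'⟩).symm⟩

lemma span_range_eq_partialIdeal {d : ℕ} (x : Fin d → R) :
    Ideal.span (Set.range x) = partialIdeal (extendZero x) d := by
  unfold partialIdeal
  congr 1
  ext c
  constructor
  · rintro ⟨j, rfl⟩
    exact ⟨j, j.2, extendZero_fin x j⟩
  · rintro ⟨j, hj, rfl⟩
    exact ⟨⟨j, hj⟩, (extendZero_fin x ⟨j, hj⟩).symm⟩

end FinSequences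

/-! ### Reductions, and the change from y to x. -/

section Reductions

variable {R : Type*} [CommRing R]

lemma IsReduction.exists_pow_le {J I : Ideal R} (h : IsReduction J I) :
    ∃ n, I ^ (n + 1) ≤ J * I ^ n := h.2.imp fun _ hn => hn.ge

lemma exists_superficial {x : ℕ → R} {d : ℕ} {I₁ I₂ : Ideal R}
    (hreg : ∀ i < d, IsRegularMod (partialIdeal x i) (x i))
    (hsup : ∀ i < d, IsSuperficial (Ideal.Quotient.mk (partialIdeal x i) (x i))
      (I₂.map (Ideal.Quotient.mk (partialIdeal x i)))
      (I₁.map (Ideal.Quotient.mk (partialIdeal x i)))) :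
    ∃ N, ∀ i < d, ∀ r ≥ N, ∀ k c, x i * c ∈ I₁ ^ k * I₂ ^ (r + 1) ⊔ partialIdeal x i →
      c ∈ I₁ ^ k * I₂ ^ r ⊔ partialIdeal x i := by
  choose! N hN using fun i (hi : i < d) => (hsup i hi).mem_of_mul_mem (hreg i hi)
  exact ⟨(Finset.range d).sup N, fun i hi r hr =>
    hN i hi r ((Finset.le_sup (Finset.mem_range.2 hi)).trans hr)⟩

/-- For c ∈ I₂ the product `x 0 * c` lies in J ∩ I₁I₂ = I₁J, and I₁J : `x 0` = I₁. -/
lemma le_of_inf_mul_eq {x : ℕ → R} {d : ℕ} (hd : 0 < d) {I₁ I₂ : Ideal R}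
    (hreg : ∀ i < d, IsRegularMod (partialIdeal x i) (x i)) (hJ₁ : partialIdeal x d ≤ I₁)
    (hint : partialIdeal x d ⊓ (I₁ * I₂) = I₁ * partialIdeal x d) : I₂ ≤ I₁ := by
  intro c hc
  have hx := mem_partialIdeal x hd
  refine mem_of_mul_mem_mul_partialIdeal_sup hd hreg hJ₁ (Ideal.mem_sup_left ?_)
  rw [← hint]
  exact ⟨Ideal.mul_mem_right _ _ hx, Ideal.mul_mem_mul (hJ₁ hx) hc⟩

variable [IsLocalRing R]

lemma IsReduction.maximalIdeal_le_radical {J I : Ideal R} (hI : IsMPrimary I)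
    (h : IsReduction J I) : maximalIdeal R ≤ J.radical := by
  obtain ⟨n, hn⟩ := h.exists_pow_le
  rw [← hI, ← Ideal.radical_pow I (Nat.succ_ne_zero n)]
  exact Ideal.radical_mono (hn.trans Ideal.mul_le_left)

variable [IsNoetherianRing R]

lemma IsReduction.exists_maximalIdeal_pow_le {J I : Ideal R} (hI : IsMPrimary I)
    (h : IsReduction J I) : ∃ k, maximalIdeal R ^ k ≤ J :=
  Ideal.exists_pow_le_of_le_radical_of_fg (h.maximalIdeal_le_radical hI)
    (IsNoetherian.noetherian _)

/-- In a Cohen-Macaulay local ring of dimension `d`, a sequence of length `d` that generates a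
reduction of an ideal primary to the maximal ideal is regular. -/
lemma IsReduction.isRegularMod {x : ℕ → R} {d : ℕ} {I : Ideal R} (hCM : IsCohenMacaulayLocal R)
    (hdim : ringKrullDim R = ((d : ℕ∞) : WithBot ℕ∞)) (hI : IsMPrimary I)
    (h : IsReduction (partialIdeal x d) I) :
    ∀ i < d, IsRegularMod (partialIdeal x i) (x i) := by
  obtain ⟨rs, hrs, hreg, hlen⟩ := hCM
  have hd : rs.length = d := by
    rw [hdim] at hlen
    exact_mod_cast hlen
  refine isRegularMod_partialIdeal (hd ▸ hasRegularChain_of_isRegular hrs hreg.toIsWeaklyRegular)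
    (fun i hi => ?_) (h.maximalIdeal_le_radical hI)
  rw [← hI]
  exact Ideal.le_radical (h.1 (mem_partialIdeal x hi))

/-- The leading Hilbert coefficient is at most the colength of a reduction generated by a sequence
of length `d`. -/
lemma HasHilbertCoeffs.zero_le_colength {y : ℕ → R} {d : ℕ} (hd : 0 < d) {I : Ideal R}
    (hI : IsMPrimary I) (hy : IsReduction (partialIdeal y d) I) {c : ℕ → ℤ}
    (h : HasHilbertCoeffs d (fun n => colength (I ^ n)) c) :
    c 0 ≤ colength (partialIdeal y d) := by
  obtain ⟨D, rfl⟩ : ∃ D, d = D + 1 := ⟨d - 1, by omega⟩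
  have hfin : ∀ n, FiniteColength (partialIdeal y (D + 1) ^ n) := fun n => by
    obtain ⟨k, hk⟩ := IsAlmostMinimal.exists_pow_le_pow (hy.exists_maximalIdeal_pow_le hI) n
    exact finiteColength_of_pow_le hk
  refine h.zero_le_of_le (eventually_atTop.2 ⟨1, fun n hn => ?_⟩)
  obtain ⟨m, rfl⟩ : ∃ m, n = m + 1 := ⟨n - 1, by omega⟩
  have h1 := colength_pow_sup_le hfin (D + 1) le_rfl m
  rw [Nat.sub_self, partialIdeal_zero, sup_bot_eq] at h1
  rw [show m + 1 + D = m + (D + 1) by omega]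
  exact (colength_anti (hfin _) (Ideal.pow_right_mono hy.1 _)).trans h1

/-- Since ℓ(R/I₁J) = ℓ(R/J) + d ℓ(R/I₁) for both reductions, ℓ(R/(x)) ≤ ℓ(R/(y)) carries the bound
one on ℓ(I₁I₂/I₁J) from y to x. -/
lemma exists_isAlmostMinimal {x y : ℕ → R} {d : ℕ} {I₁ I₂ : Ideal R}
    (hI₂ : IsMPrimary I₂) (hx : IsReduction (partialIdeal x d) I₂)
    (hxreg : ∀ i < d, IsRegularMod (partialIdeal x i) (x i))
    (hsup : ∃ N, ∀ i < d, ∀ r ≥ N, ∀ k c, x i * c ∈ I₁ ^ k * I₂ ^ (r + 1) ⊔ partialIdeal x i →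
      c ∈ I₁ ^ k * I₂ ^ r ⊔ partialIdeal x i)
    (hle : I₂ ≤ I₁) (hy : IsReduction (partialIdeal y d) I₂)
    (hyreg : ∀ i < d, IsRegularMod (partialIdeal y i) (y i))
    (hxy : colength (partialIdeal x d) ≤ colength (partialIdeal y d))
    (hlen : quotLength (I₁ * I₂) (I₁ * partialIdeal y d) = 1) :
    ∃ a b, IsAlmostMinimal x d I₁ I₂ a b := by
  have hkx := hx.exists_maximalIdeal_pow_le hI₂
  have hfin : ∀ {J : Ideal R}, IsReduction J I₂ → FiniteColength (I₁ * J) := by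
    intro J hJ
    have hk := hJ.exists_maximalIdeal_pow_le hI₂
    obtain ⟨k, hk⟩ := IsAlmostMinimal.exists_pow_le_mul
      (hk.imp fun _ hk => hk.trans (hJ.1.trans hle)) hk
    exact finiteColength_of_pow_le hk
  have h1 := toNat_quotLength (hfin hy) (Ideal.mul_mono_right hy.1)
  rw [hlen, colength_mul_partialIdeal hyreg (hy.1.trans hle) (hfin hy)] at h1
  have h2 := colength_mul_partialIdeal hxreg (hx.1.trans hle) (hfin hx)
  obtain ⟨a, ha, b, hb, hab, hm⟩ := exists_mul_generator (Ideal.mul_mono_right hx.1) (hfin hx) (by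
    rw [ENat.toNat_one] at h1
    push_cast at h1
    linarith)
  exact ⟨a, b, hxreg, hx.1, hle, hsup, hx.exists_pow_le, hkx, ha, hb, hab, hm⟩

end Reductions

/-! ### The numerator in powers of 1 - X. -/

section Numerics

open PowerSeries

lemma X_pow_eq_sum_one_sub_X_pow {n m : ℕ} (h : n < m) :
    (X ^ n : ℚ⟦X⟧) = ∑ i ∈ Finset.range m,
      C (((-1) ^ i * (n.choose i : ℤ) : ℤ) : ℚ) * (1 - X) ^ i := by
  have h1 : (X : ℚ⟦X⟧) = -(1 - X) + 1 := by ring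
  conv_lhs => rw [h1, add_pow]
  rw [← Finset.sum_subset (Finset.range_subset_range.2 h)]
  · refine Finset.sum_congr rfl fun i _ => ?_
    rw [neg_pow, one_pow, mul_one]
    simp
    ring
  · intro i _ hi
    rw [Nat.choose_eq_zero_of_lt (by simpa using hi)]
    simp

lemma numerator_eq_sum {s m : ℕ} (h : s + 1 < m) (l e : ℤ) :
    (C (l : ℚ) - X * C (l - e + 1 : ℚ) + X ^ (s + 1) : ℚ⟦X⟧) =
      ∑ i ∈ Finset.range m, C (((-1) ^ i * ((s + 1).choose i +
        if i = 0 then e - 1 else if i = 1 then e - l - 1 else 0) : ℤ) : ℚ) * (1 - X) ^ i := by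
  have h1 : ∑ i ∈ Finset.range m, C (((-1) ^ i *
      (if i = 0 then e - 1 else if i = 1 then e - l - 1 else 0) : ℤ) : ℚ) * (1 - X : ℚ⟦X⟧) ^ i =
      C (l : ℚ) - X * C (l - e + 1 : ℚ) := by
    rw [Finset.sum_eq_add_of_mem 0 1 (by simp; omega) (by simp; omega) zero_ne_one]
    · simp only [map_add, map_sub, map_one]
      simp
      ring
    · intro i _ hi
      rw [if_neg hi.1, if_neg hi.2]
      simp
  rw [X_pow_eq_sum_one_sub_X_pow h, ← h1, ← Finset.sum_add_distrib]
  refine Finset.sum_congr rfl fun i _ => ?_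
  rw [← add_mul, ← map_add, ← Int.cast_add]
  congr 3
  ring

lemma eq_mul_inv_one_sub_X_pow {f g : ℚ⟦X⟧} {n : ℕ} (h : f * (1 - X) ^ n = g) :
    f = g * ((1 - X) ^ n)⁻¹ := by
  rw [PowerSeries.eq_mul_inv_iff_mul_eq (by simp)]
  exact h

end Numerics

/-! ### Coefficients of a difference with equal leading terms. -/

section FiberCoefficients

lemma HasHilbertCoeffs.sub {D : ℕ} {H G e g : ℕ → ℤ} (hH : HasHilbertCoeffs (D + 1) H e)
    (hG : HasHilbertCoeffs (D + 1) G g) (h0 : g 0 = e 0) :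
    HasHilbertCoeffs D (fun n => G n - H n) fun i => e (i + 1) - g (i + 1) := by
  refine ⟨?_, fun i hi => by beta_reduce; rw [hH.2 _ (by omega), hG.2 _ (by omega), sub_self]⟩
  filter_upwards [hH.1, hG.1] with n hn hn'
  rw [hn, hn', ← Finset.sum_sub_distrib, Finset.sum_range_succ', h0, sub_self, add_zero]
  refine Finset.sum_congr rfl fun i _ => ?_
  rw [Nat.succ_sub_succ, pow_succ]
  ring

end FiberCoefficients

end FiberCone

/-! ### The main theorem. -/

theorem mainTheorem8 {R : Type*} [CommRing R] [IsLocalRing R] [IsNoetherianRing R]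
    [Infinite (IsLocalRing.ResidueField R)]
    (hCM : FiberCone.IsCohenMacaulayLocal R)
    (d : ℕ) (hd : 2 ≤ d) (hdim : ringKrullDim R = ((d : ℕ∞) : WithBot ℕ∞))
    (I₁ I₂ : Ideal R) (hI₁ : FiberCone.IsMPrimary I₁) (hI₂ : FiberCone.IsMPrimary I₂)
    (x : Fin d → R) (J : Ideal R) (hJ : J = Ideal.span (Set.range x))
    (hmin : FiberCone.IsMinimalReduction J I₂)
    (hsup : FiberCone.IsSuperficialSequence x I₂ I₁)
    (hJI₁ : J ≤ I₁)
    (hint : J ⊓ (I₁ * I₂) = I₁ * J)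
    (hamm : FiberCone.HasAlmostMinimalMultiplicity d I₂ I₁)
    (s : ℕ) (hs : s = FiberCone.sNumber J I₁ I₂) :
    -- The three Hilbert functions are of polynomial type, with the named coefficients.
    FiberCone.HasHilbertCoeffs d (fun n => FiberCone.colength (I₂ ^ n)) (FiberCone.eCoeff d I₂) ∧
    FiberCone.HasHilbertCoeffs d (FiberCone.hilbertFn I₁ I₂ 1) (FiberCone.gCoeff d I₁ I₂) ∧
    FiberCone.HasHilbertCoeffs (d - 1) (FiberCone.fiberHilbertFn I₁ I₂)
      (FiberCone.fCoeff d I₁ I₂) ∧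
    -- (1)
    FiberCone.hilbertSeries (FiberCone.hilbertFn I₁ I₂ 1) =
      (PowerSeries.C (FiberCone.colength I₁ : ℚ)
        - PowerSeries.X * PowerSeries.C
            (FiberCone.colength I₁ - FiberCone.eCoeff d I₂ 0 + 1 : ℚ)
        + PowerSeries.X ^ (s + 1)) * ((1 - PowerSeries.X) ^ (d + 1))⁻¹ ∧
    -- (2)
    FiberCone.gCoeff d I₁ I₂ 1 = FiberCone.eCoeff d I₂ 0 - FiberCone.colength I₁ + s ∧
    (∀ i, 2 ≤ i → i ≤ d → FiberCone.gCoeff d I₁ I₂ i = ((s + 1).choose i : ℤ)) ∧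
    -- (3)
    FiberCone.hilbertSeries (FiberCone.fiberHilbertFn I₁ I₂) =
      (PowerSeries.C (FiberCone.colength I₁ : ℚ)
        - PowerSeries.X * PowerSeries.C
            (FiberCone.colength I₁ - FiberCone.eCoeff d I₂ 0 + 1 : ℚ)
        + PowerSeries.X ^ (s + 1)) * ((1 - PowerSeries.X) ^ (d + 1))⁻¹
        - FiberCone.hilbertSeries (FiberCone.hilbertFn I₁ I₂ 0) ∧
    -- (4)
    FiberCone.fCoeff d I₁ I₂ 0 =
      FiberCone.eCoeff d I₂ 1 - FiberCone.eCoeff d I₂ 0 + FiberCone.colength I₁ - s ∧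
    (∀ i, 1 ≤ i → i ≤ d - 1 →
      FiberCone.fCoeff d I₁ I₂ i = FiberCone.eCoeff d I₂ (i + 1) - ((s + 1).choose (i + 1) : ℤ)) := by
  have hd0 : 0 < d := by omega
  obtain ⟨y, ⟨hy, -⟩, hlen⟩ := hamm
  rw [FiberCone.span_range_eq_partialIdeal] at hJ hy hlen
  subst hJ
  have hx := hmin.1
  set u := FiberCone.extendZero x with hu
  have hreg := hx.isRegularMod hCM hdim hI₂
  have hsup' := FiberCone.exists_superficial (x := u) (I₁ := I₁) (I₂ := I₂) hreg fun i hi => by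
    -- The quotient ring depends on the ideal, so the ideal is generalized before the two
    -- descriptions of it are identified.
    obtain ⟨Q, hQ⟩ : ∃ Q, Q = FiberCone.partialIdeal u i := ⟨_, rfl⟩
    rw [← hQ]
    obtain rfl : FiberCone.initialIdeal x ⟨i, hi⟩ = Q :=
      (FiberCone.initialIdeal_eq_partialIdeal x ⟨i, hi⟩).trans hQ.symm
    rw [hu, FiberCone.extendZero_fin x ⟨i, hi⟩]
    exact hsup ⟨i, hi⟩
  have hle := FiberCone.le_of_inf_mul_eq hd0 hreg hJI₁ hint
  have hfin : ∀ n, FiberCone.FiniteColength (I₂ ^ n) := fun n => by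
    obtain ⟨k, hk⟩ := FiberCone.IsAlmostMinimal.exists_pow_le_pow
      ((hx.exists_maximalIdeal_pow_le hI₂).imp fun _ hk => hk.trans hx.1) n
    exact FiberCone.finiteColength_of_pow_le hk
  obtain ⟨c, hc, hc0⟩ : ∃ c, FiberCone.HasHilbertCoeffs d (fun n => FiberCone.colength (I₂ ^ n)) c ∧
      c 0 = FiberCone.colength (FiberCone.partialIdeal u d) := by
    obtain ⟨N, hN⟩ := hsup'
    obtain ⟨N', hN'⟩ := hx.exists_pow_le
    refine FiberCone.exists_hasHilbertCoeffs (N := N) hfin hx.1 (fun i hi n hn c hc => ?_)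
      (hN'.trans Ideal.mul_le_left)
    simpa using hN i hi n hn 0 c (by simpa using hc)
  obtain ⟨a, b, hab⟩ := FiberCone.exists_isAlmostMinimal hI₂ hx hreg hsup' hle hy
    (hy.isRegularMod hCM hdim hI₂) (hc0 ▸ hc.zero_le_colength hd0 hI₂ hy) hlen
  have he : FiberCone.eCoeff d I₂ = c := hc.hilbertCoeff_eq
  rw [he]
  obtain ⟨D, rfl⟩ : ∃ D, d = D + 1 := ⟨d - 1, by omega⟩
  have hseries : FiberCone.hilbertSeries (FiberCone.hilbertFn I₁ I₂ 1) *
      (1 - PowerSeries.X) ^ (D + 2) = PowerSeries.C (FiberCone.colength I₁ : ℚ)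
        - PowerSeries.X * PowerSeries.C (FiberCone.colength I₁ - c 0 + 1 : ℚ)
        + PowerSeries.X ^ (s + 1) := by
    have hH : FiberCone.hilbertFn I₁ I₂ 1 = fun n => FiberCone.colength
        (FiberCone.fiberFiltration I₁ I₂ (n + 1) ⊔ FiberCone.partialIdeal u (D - D)) := by
      funext n
      rw [Nat.sub_self, FiberCone.partialIdeal_zero, sup_bot_eq, FiberCone.fiberFiltration_succ,
        FiberCone.hilbertFn, pow_one]
    rw [hH, hs, hc0]
    exact hab.hilbertSeries_mul_pow D le_rfl
  -- The number of terms m only has to exceed both s + 1, the exponent in the numerator, and D + 1 =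
  -- d.
  have hg := FiberCone.hasHilbertCoeffs_of_hilbertSeries (D := D + 1) (m := D + s + 3)
    (hseries.trans (FiberCone.numerator_eq_sum (by omega) _ _)) (by omega)
  have hg' : FiberCone.gCoeff (D + 1) I₁ I₂ = _ := hg.hilbertCoeff_eq
  have hfib : FiberCone.fiberHilbertFn I₁ I₂ =
      fun n => FiberCone.hilbertFn I₁ I₂ 1 n - FiberCone.colength (I₂ ^ n) := by
    funext n
    rw [FiberCone.fiberHilbertFn, FiberCone.hilbertFn, pow_one]
    exact FiberCone.toNat_quotLength (hab.finiteColength (n + 1)) Ideal.mul_le_right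
  -- Here g₀ = 1 + (e₀ - 1) = e₀, so the leading terms cancel and fᵢ = eᵢ₊₁ - gᵢ₊₁.
  have hf := hc.sub hg (by simp)
  rw [← hfib] at hf
  have hf' : FiberCone.fCoeff (D + 1) I₁ I₂ = _ := hf.hilbertCoeff_eq
  refine ⟨hc, hg' ▸ hg, hf' ▸ hf, FiberCone.eq_mul_inv_one_sub_X_pow hseries, ?_, fun i hi hid => ?_,
    ?_, ?_, fun i hi hid => ?_⟩
  · rw [hg']
    simp
    ring
  · rw [hg']
    beta_reduce
    rw [if_pos hid, if_neg (by omega), if_neg (by omega), add_zero]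
  · rw [← FiberCone.eq_mul_inv_one_sub_X_pow hseries, hfib]
    ext n
    simp [FiberCone.hilbertSeries, FiberCone.hilbertFn]
  · rw [hf']
    simp
    ring
  · rw [hf']
    beta_reduce
    rw [if_pos (by omega), if_neg (by omega), if_neg (by omega), add_zero]
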